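/- Let $J=[-1,1]$ and, for $n\in\mathbb N$, let $\mathscr G^{2n}_n(\mathbb C)$ be the Grassmannian of $n$-dimensional subspaces of $\mathbb C^{2n}$ with its usual topology, given for instance by the gap metric $d(X,Y)=\|P_X-P_Y\|$, where $P_X$ is the orthogonal projection onto $X$. For every $n\in\mathbb N$ there is a constant $c=c(n)>0$ such that the following holds. Let $c^>,c^<:J\to\mathbb R$ be functions with $c^>(\tau)+c^<(\tau)>0$ for all $\tau\in J$, and let $A,R:J\to \mathrm{GL}_{2n}(\mathbb C)$ be smooth ($C^\infty$ on $J$, one-sided at the end points) such that for all $\tau\in J$ $$R(\tau)^{-1}A(\tau)R(\tau)=\begin{pmatrix}A^>(\tau)&0\\0&A^<(\tau)\end{pmatrix},\qquad A^>(\tau),A^<(\tau)\in\mathbb C^{n\times n},$$ and for all $\tau\in J$ and all $\eta\in\mathbb C^n$ $$\mathrm{Re}\langle\eta,A^>(\tau)\eta\rangle\ge c^>(\tau)|\eta|^2,\qquad \mathrm{Re}\langle\eta,A^>(\tau)^T\eta\rangle\ge c^>(\tau)|\eta|^2,$$ $$\mathrm{Re}\langle\eta,A^<(\tau)\eta\rangle\le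 -c^<(\tau)|\eta|^2,\qquad \mathrm{Re}\langle\eta,A^<(\tau)^T\eta\rangle\le -c^<(\tau)|\eta|^2,$$ where $T$ is the transpose without complex conjugation. Let $h:J\to(0,\infty)$ be smooth and let $\chi:\mathbb R\to(-1,1)$ be the solution of $\chi'=(1-\chi^2)h(\chi)$, $\chi(0)=0$. Let $U(\tau)$ and $S(\tau)$ be the subspaces spanned by the first $n$ and by the last $n$ columns of $R(\tau)$, respectively. A map $X:\mathbb R\to\mathscr G^{2n}_n(\mathbb C)$ is called a Grassmannian solution of the linear system $\xi'=A(\chi)\xi$ if there are $n$ solutions $\xi_1,\dots,\xi_n:\mathbb R\to\mathbb C^{2n}$ of this system with $X(x)=\mathrm{span}\{\xi_1(x),\dots,\xi_n(x)\}$ for all $x\in\mathbb R$. Then there is exactly one Grassmannian solution $X^-$ with $X^-(x)\to U(-1)$ as $x\to-\infty$, and exactly one Grassmannian solution $X^+$ with $X^+(x)\to S(+1)$ as $x\to+\infty$. If moreover $$\left|R(0)^{-1}\frac{dR}{d\tau}(\tau)\right|\le c\qquad\text{for all }\tau\in J$$ (operator norm for the Euclidean norm), then $$\lim_{x\to+\infty}X^-(x)=U(+1)\qquad\text{and}\qquad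 \lim_{x\to-\infty}X^+(x)=S(-1).$$ -/

import Mathlib

open Set Filter Topology
open scoped ContDiff Matrix Matrix.Norms.L2Operator MatrixGroups

noncomputable section

/-- The Grassmannian of `m`-dimensional subspaces of `ℂ^ι`. -/
def Grass (ι : Type) [Fintype ι] (m : ℕ) : Type :=
  {X : Submodule ℂ (EuclideanSpace ℂ ι) // Module.finrank ℂ X = m}

/-- The orthogonal projection of `ℂ^ι` onto the subspace `X`. -/
def Grass.proj {ι : Type} [Fintype ι] {m : ℕ} (X : Grass ι m) :
    EuclideanSpace ℂ ι →L[ℂ] EuclideanSpace ℂ ι :=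
  X.1.starProjection

theorem Grass.proj_injective {ι : Type} [Fintype ι] {m : ℕ} :
    Function.Injective (Grass.proj : Grass ι m → _) :=
  fun _ _ h => Subtype.ext (Submodule.starProjection_inj.1 h)

/-- The gap metric `d(X, Y) = ‖P_X - P_Y‖`, with `P_X` the orthogonal projection onto `X`; it
induces the usual topology of the Grassmannian. -/
instance Grass.metricSpace (ι : Type) [Fintype ι] (m : ℕ) : MetricSpace (Grass ι m) :=
  MetricSpace.induced Grass.proj Grass.proj_injective inferInstance

/-- The `k`-th column of a matrix, as a vector of `ℂ^ι`. -/
def colVec {ι κ : Type} (P : Matrix ι κ ℂ) (k : κ) : EuclideanSpace ℂ ι :=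
  WithLp.toLp 2 (P.col k)

theorem linearIndependent_colVec {ι : Type} [Fintype ι] [DecidableEq ι] (P : GL ι ℂ) :
    LinearIndependent ℂ (colVec (P : Matrix ι ι ℂ)) :=
  (Matrix.linearIndependent_cols_of_isUnit P.isUnit).map'
    (WithLp.linearEquiv 2 ℂ (ι → ℂ)).symm.toLinearMap (LinearEquiv.ker _)

/-- The subspace spanned by the columns of an invertible matrix whose indices lie in the image of the
injection `f`. -/
def spanCols {ι : Type} [Fintype ι] [DecidableEq ι] {m : ℕ} (P : GL ι ℂ) (f : Fin m ↪ ι) :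
    Grass ι m :=
  ⟨Submodule.span ℂ (range (colVec (P : Matrix ι ι ℂ) ∘ f)), by
    have h := finrank_span_eq_card ((linearIndependent_colVec P).comp f f.injective)
    rwa [Fintype.card_fin] at h⟩

/-- The subspace of `ℂ^{2n}` spanned by the first `n` columns of an invertible matrix. -/
def spanFirst {n : ℕ} (P : GL (Fin n ⊕ Fin n) ℂ) : Grass (Fin n ⊕ Fin n) n :=
  spanCols P ⟨Sum.inl, Sum.inl_injective⟩

/-- The subspace of `ℂ^{2n}` spanned by the last `n` columns of an invertible matrix. -/
def spanLast {n : ℕ} (P : GL (Fin n ⊕ Fin n) ℂ) : Grass (Fin n ⊕ Fin n) n :=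
  spanCols P ⟨Sum.inr, Sum.inr_injective⟩

/-- `X : ℝ → Grass ι m` solves the Grassmannian equation `X' = Γ^m(B(x)) X` associated with the
linear system `ξ' = B(x) ξ`: there are `m` solutions of the linear system whose values at each `x`
span `X x` (they are then linearly independent at each `x`, since `X x` has dimension `m`). -/
def IsGrassSolution {ι : Type} [Fintype ι] [DecidableEq ι] {m : ℕ}
    (B : ℝ → Matrix ι ι ℂ) (X : ℝ → Grass ι m) : Prop :=
  ∃ ξ : Fin m → ℝ → EuclideanSpace ℂ ι,
    (∀ j x, HasDerivAt (ξ j) (Matrix.toEuclideanLin (B x) (ξ j x)) x) ∧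
      ∀ x, (X x).1 = Submodule.span ℂ (range fun j => ξ j x)

/-- The matrix functions `A` and `R` with the block-diagonalization and the definiteness bounds. Functions on `J = [-1, 1]` are
given as functions on `ℝ` of which only the restrictions to `J` are used; in particular smoothness
is smoothness on `J` (one-sided at the end points). -/
structure BlockData {n : ℕ} (cgt clt : ℝ → ℝ) (A R : ℝ → GL (Fin n ⊕ Fin n) ℂ)
    (Agt Alt : ℝ → Matrix (Fin n) (Fin n) ℂ) : Prop where
  smooth_A : ContDiffOn ℝ ∞ (fun τ => (A τ : Matrix (Fin n ⊕ Fin n) (Fin n ⊕ Fin n) ℂ))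
    (Icc (-1) 1)
  smooth_R : ContDiffOn ℝ ∞ (fun τ => (R τ : Matrix (Fin n ⊕ Fin n) (Fin n ⊕ Fin n) ℂ))
    (Icc (-1) 1)
  pos : ∀ τ ∈ Icc (-1 : ℝ) 1, 0 < cgt τ + clt τ
  block : ∀ τ ∈ Icc (-1 : ℝ) 1,
    (((R τ)⁻¹ * A τ * R τ : GL (Fin n ⊕ Fin n) ℂ) : Matrix (Fin n ⊕ Fin n) (Fin n ⊕ Fin n) ℂ) =
      Matrix.fromBlocks (Agt τ) 0 0 (Alt τ)
  gt : ∀ τ ∈ Icc (-1 : ℝ) 1, ∀ η : EuclideanSpace ℂ (Fin n),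
    cgt τ * ‖η‖ ^ 2 ≤ (inner ℂ η (Matrix.toEuclideanLin (Agt τ) η)).re
  gt_transpose : ∀ τ ∈ Icc (-1 : ℝ) 1, ∀ η : EuclideanSpace ℂ (Fin n),
    cgt τ * ‖η‖ ^ 2 ≤ (inner ℂ η (Matrix.toEuclideanLin (Agt τ)ᵀ η)).re
  lt : ∀ τ ∈ Icc (-1 : ℝ) 1, ∀ η : EuclideanSpace ℂ (Fin n),
    (inner ℂ η (Matrix.toEuclideanLin (Alt τ) η)).re ≤ -clt τ * ‖η‖ ^ 2
  lt_transpose : ∀ τ ∈ Icc (-1 : ℝ) 1, ∀ η : EuclideanSpace ℂ (Fin n),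
    (inner ℂ η (Matrix.toEuclideanLin (Alt τ)ᵀ η)).re ≤ -clt τ * ‖η‖ ^ 2

end

/-! ### Linear differential equations with continuous coefficients. -/

section LinearODE

variable {W : Type*} [NormedAddCommGroup W] [NormedSpace ℝ W]

/-! In the moving frame `ζ = R(χ)⁻¹ ξ = (U ξ, V ξ)` the system becomes block diagonal up to the term
`-χ' R⁻¹ R' ζ`. The blocks separate the growth rates of `U` and `V` by a positive gap, and the
coupling has norm at most `k χ'`, where `k` bounds `‖R⁻¹ R'‖`. Hence a cone `‖V ξ‖ ≤ r ‖U ξ‖` is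
forward invariant as soon as `k χ' (1 + r)² < r' + gap * r` (`cone_invariant`).

With `s = χ + 1`, the function `r = k s / (1 - k s)` satisfies `r' = k s' (1 + r)²`, so the gap
makes the inequality strict. This `r` tends to `0` at `-∞`. The solution spaces starting in `ker V`
at `-N` stay in these cones, and a limit as `N → ∞` gives `X⁻` (`exists_inNarrowCone`). Uniqueness
holds because two different spaces in the unit cone near `-∞` would contain solutions whose
difference lies outside the cone, and such a difference cannot decay backwards as fast as its two
terms do (`submodule_eq_of_eventually_atBot`).

For `k ≤ 1/4` one has `k s < 1/2`, so `r` exists and is at most `1` on the whole line. Near `+∞` the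
coupling vanishes and the uniform gap then shrinks the cone to its axis
(`InNarrowCone.eventually_atTop`). Smallness of `R(0)⁻¹ R'` yields this `k`. Reversing `x` and
exchanging `U` and `V` turns the statements on `X⁻` into those on `X⁺`. -/

theorem norm_le_exp_mul_of_norm_deriv_le_right {f f' : ℝ → W} {K T : ℝ}
    (hf : ∀ t ∈ Icc (-T) T, HasDerivWithinAt f (f' t) (Icc (-T) T) t)
    (hK : ∀ t ∈ Icc (-T) T, ‖f' t‖ ≤ K * ‖f t‖) {t : ℝ} (ht : t ∈ Icc 0 T) :
    ‖f t‖ ≤ ‖f 0‖ * Real.exp (K * t) := by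
  have hsub : Icc 0 T ⊆ Icc (-T) T := Icc_subset_Icc (by linarith [ht.1, ht.2]) le_rfl
  have h := norm_le_gronwallBound_of_norm_deriv_right_le (f := f) (f' := f') (δ := ‖f 0‖) (K := K)
    (ε := 0) (a := 0) (b := T) (fun t ht => ((hf t (hsub ht)).continuousWithinAt).mono hsub)
    (fun x hx => (hf x (hsub (Ico_subset_Icc_self hx))).mono_of_mem_nhdsWithin
      (mem_of_superset (Icc_mem_nhdsGE hx.2) (Icc_subset_Icc (by linarith [hx.1, hx.2]) le_rfl)))
    le_rfl (fun x hx => by simpa using hK x (hsub (Ico_subset_Icc_self hx))) t ht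
  simpa [gronwallBound_ε0] using h

/-- A priori bound for a function whose derivative is controlled by its norm. -/
theorem norm_le_exp_mul_of_norm_deriv_le {f f' : ℝ → W} {K T : ℝ} (hK0 : 0 ≤ K)
    (hf : ∀ t ∈ Icc (-T) T, HasDerivWithinAt f (f' t) (Icc (-T) T) t)
    (hK : ∀ t ∈ Icc (-T) T, ‖f' t‖ ≤ K * ‖f t‖) {t : ℝ} (ht : t ∈ Icc (-T) T) :
    ‖f t‖ ≤ ‖f 0‖ * Real.exp (K * T) := by
  have hneg : ∀ s ∈ Icc (-T) T, -s ∈ Icc (-T) T := fun s hs =>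
    ⟨by linarith [hs.2], by linarith [hs.1]⟩
  rcases le_total 0 t with h0 | h0
  · refine (norm_le_exp_mul_of_norm_deriv_le_right hf hK ⟨h0, ht.2⟩).trans ?_
    gcongr
    exact ht.2
  · have h := norm_le_exp_mul_of_norm_deriv_le_right (f := fun s => f (-s))
      (f' := fun s => -f' (-s)) (K := K) (T := T) (fun s hs => by
        have := (hf (-s) (hneg s hs)).scomp s (hasDerivAt_neg s).hasDerivWithinAt
          (fun r hr => hneg r hr)
        simpa [Function.comp_def] using this) (fun s hs => by simpa using hK _ (hneg s hs))
      (t := -t) ⟨by linarith, by linarith [ht.1]⟩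
    simp only [neg_neg, neg_zero] at h
    refine h.trans ?_
    gcongr
    linarith [ht.1]

variable [FiniteDimensional ℝ W]

/-- Truncating the field outside a large ball makes it bounded, so that a single application of
Picard–Lindelöf covers `[-T, T]`. Gronwall's inequality keeps the solution inside the ball where
nothing was changed. -/
theorem exists_linearODE_solution_Icc {G : ℝ → W →L[ℝ] W} (hG : Continuous G) (w₀ : W) {T : ℝ}
    (hT : 0 ≤ T) :
    ∃ α : ℝ → W, α 0 = w₀ ∧
      ∀ t ∈ Icc (-T) T, HasDerivWithinAt α (G t (α t)) (Icc (-T) T) t := by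
  obtain ⟨K, hK⟩ := isCompact_Icc.exists_bound_of_continuousOn (s := Icc (-T) T) hG.continuousOn
  have hK0 : 0 ≤ K := (norm_nonneg _).trans (hK 0 ⟨by linarith, hT⟩)
  have hrpos : 0 < ‖w₀‖ * Real.exp (K * T) + 1 := by positivity
  -- The inner radius exceeds the a priori bound `‖w₀‖ exp (K T)`, which also holds for the
  -- truncated equation because `‖g w‖ ≤ ‖w‖`.
  let φ : ContDiffBump (0 : W) :=
    ⟨‖w₀‖ * Real.exp (K * T) + 1, ‖w₀‖ * Real.exp (K * T) + 2, hrpos, by linarith⟩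
  let g : W → W := fun w => φ w • w
  have hgs : HasCompactSupport g := φ.hasCompactSupport.smul_right
  have hgc : ContDiff ℝ 1 g := φ.contDiff.smul contDiff_id
  obtain ⟨C, hC⟩ := hgc.lipschitzWith_of_hasCompactSupport hgs one_ne_zero
  obtain ⟨M, hM⟩ := hgs.exists_bound_of_continuous hgc.continuous
  have hM0 : 0 ≤ M := (norm_nonneg _).trans (hM 0)
  have hgn : ∀ w, ‖g w‖ ≤ ‖w‖ := fun w => by
    rw [norm_smul, Real.norm_of_nonneg φ.nonneg]
    exact mul_le_of_le_one_left (norm_nonneg _) φ.le_one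
  have hPL : IsPicardLindelof (fun t w => G t (g w)) (tmin := -T) (tmax := T)
      ⟨0, by linarith, hT⟩ w₀ (⟨K * M, by positivity⟩ * ⟨T, hT⟩) 0 ⟨K * M, by positivity⟩
      (⟨K, hK0⟩ * C) := by
    refine ⟨fun t ht => LipschitzWith.lipschitzOnWith ?_, fun w _ => ?_, fun t ht w _ => ?_, ?_⟩
    · refine (LipschitzWith.comp (Kg := C) (Kf := ⟨K, hK0⟩) ?_ hC)
      exact (G t).lipschitz.weaken (by exact_mod_cast hK t ht)
    · exact (hG.clm_apply continuous_const).continuousOn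
    · exact ((G t).le_opNorm _).trans (mul_le_mul (hK t ht) (hM w) (norm_nonneg _) hK0)
    · simp
      exact le_rfl
  obtain ⟨α, h0, hα⟩ := hPL.exists_eq_forall_mem_Icc_hasDerivWithinAt₀
  have h0' : α 0 = w₀ := h0
  refine ⟨α, h0', fun t ht => ?_⟩
  have hb : ‖α t‖ ≤ ‖w₀‖ * Real.exp (K * T) := by
    rw [← h0']
    exact norm_le_exp_mul_of_norm_deriv_le hK0 hα (fun s hs => ((G s).le_opNorm _).trans
      (mul_le_mul (hK s hs) (hgn _) (norm_nonneg _) hK0)) ht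
  have hg : g (α t) = α t := by
    have : φ (α t) = 1 := φ.one_of_mem_closedBall (by
      rw [mem_closedBall_zero_iff]
      exact hb.trans (by change _ ≤ ‖w₀‖ * Real.exp (K * T) + 1; linarith))
    simp [g, this]
  have := hα t ht
  rwa [hg] at this

/-- A linear differential equation with continuous coefficients has global solutions. -/
theorem exists_linearODE_solution {G : ℝ → W →L[ℝ] W} (hG : Continuous G) (w₀ : W) :
    ∃ α : ℝ → W, α 0 = w₀ ∧ ∀ t, HasDerivAt α (G t (α t)) t := by
  choose α h0 hα using fun N : ℕ => exists_linearODE_solution_Icc hG w₀ (Nat.cast_nonneg (α := ℝ) N)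
  have hderiv : ∀ N : ℕ, ∀ t ∈ Ioo (-(N : ℝ)) N, HasDerivAt (α N) (G t (α N t)) t :=
    fun N t ht => (hα N t (Ioo_subset_Icc_self ht)).hasDerivAt (Icc_mem_nhds ht.1 ht.2)
  have heq : ∀ N M : ℕ, N ≤ M → EqOn (α N) (α M) (Ioo (-(N : ℝ)) N) := by
    intro N M hNM t ht
    have hNM' : (N : ℝ) ≤ M := by exact_mod_cast hNM
    obtain ⟨K, hK⟩ := isCompact_Icc.exists_bound_of_continuousOn (s := Icc (-(N : ℝ)) N)
      hG.continuousOn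
    have hN : (0 : ℝ) < N := by linarith [ht.1, ht.2]
    have hK0 : 0 ≤ K := (norm_nonneg _).trans (hK 0 ⟨by linarith, hN.le⟩)
    refine ODE_solution_unique_of_mem_Ioo (v := fun t w => G t w) (s := fun _ => univ)
      (K := ⟨K, hK0⟩) (t₀ := 0)
      (fun t ht => ((G t).lipschitz.weaken (by
        exact_mod_cast hK t (Ioo_subset_Icc_self ht))).lipschitzOnWith)
      ⟨by linarith, hN⟩ (fun t ht => ⟨hderiv N t ht, trivial⟩)
      (fun t ht => ⟨hderiv M t ⟨by linarith [ht.1], by linarith [ht.2]⟩, trivial⟩)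
      ((h0 N).trans (h0 M).symm) ht
  -- The `+ 1` puts `t` in the open interval, where the derivative is two-sided.
  have hn : ∀ t : ℝ, t ∈ Ioo (-((⌈|t|⌉₊ + 1 : ℕ) : ℝ)) (⌈|t|⌉₊ + 1 : ℕ) := fun t => by
    have h := Nat.le_ceil |t|
    have h' := abs_le.1 h
    push_cast
    constructor <;> linarith [h'.1, h'.2]
  refine ⟨fun t => α (⌈|t|⌉₊ + 1) t, by simp [h0], fun t => ?_⟩
  refine (hderiv _ t (hn t)).congr_of_eventuallyEq ?_
  filter_upwards [Ioo_mem_nhds (hn t).1 (hn t).2] with s hs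
  rcases le_total (⌈|t|⌉₊ + 1) (⌈|s|⌉₊ + 1) with h | h
  · exact (heq _ _ h hs).symm
  · exact heq _ _ h (hn s)

end LinearODE

/-! ### The fundamental solution of a complex linear system on the real line. -/

section Fundamental

variable {E : Type*} [NormedAddCommGroup E] [NormedSpace ℂ E] 

theorem HasDerivAt.complex_clm_apply {F : Type*} [NormedAddCommGroup F] [NormedSpace ℂ F]
    {f : ℝ → E →L[ℂ] F} {f' : E →L[ℂ] F} {g : ℝ → E} {g' : E} {x : ℝ}
    (hf : HasDerivAt f f' x) (hg : HasDerivAt g g' x) :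
    HasDerivAt (fun x => f x (g x)) (f' (g x) + f x g') x := by
  have h : HasDerivAt (fun x => (f x).restrictScalars ℝ) (f'.restrictScalars ℝ) x :=
    (ContinuousLinearMap.restrictScalarsL ℂ E F ℝ ℝ).hasFDerivAt.comp_hasDerivAt x hf
  exact h.clm_apply hg

/-- The fundamental solution of `ξ' = B(x) ξ`, together with its inverse. -/
theorem exists_fundamental_solution [FiniteDimensional ℂ E] {B : ℝ → E →L[ℂ] E}
    (hB : Continuous B) :
    ∃ Φ : ℝ → E ≃L[ℂ] E,
      (∀ e x, HasDerivAt (fun x => Φ x e) (B x (Φ x e)) x) ∧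
      ∀ ξ : ℝ → E, (∀ x, HasDerivAt ξ (B x (ξ x)) x) → ∃ e, ∀ x, ξ x = Φ x e := by
  have : FiniteDimensional ℝ (E →L[ℂ] E) := FiniteDimensional.complexToReal _
  obtain ⟨Φ, hΦ0, hΦ⟩ := exists_linearODE_solution
    (G := fun x => (ContinuousLinearMap.mul ℝ (E →L[ℂ] E)) (B x))
    ((ContinuousLinearMap.mul ℝ (E →L[ℂ] E)).continuous.comp hB) (1 : E →L[ℂ] E)
  -- `Ψ` solves the adjoint equation `Ψ' = -Ψ B`, so `Ψ Φ` is constant, and so is `Ψ ξ` for every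
  -- solution `ξ`.
  obtain ⟨Ψ, hΨ0, hΨ⟩ := exists_linearODE_solution
    (G := fun x => -(ContinuousLinearMap.mul ℝ (E →L[ℂ] E)).flip (B x))
    (((ContinuousLinearMap.mul ℝ (E →L[ℂ] E)).flip.continuous.comp hB).neg) (1 : E →L[ℂ] E)
  have hΨ' : ∀ x, HasDerivAt Ψ (-(Ψ x * B x)) x := fun x => by simpa using hΨ x
  have hΦ' : ∀ x, HasDerivAt Φ (B x * Φ x) x := fun x => by simpa using hΦ x
  have hΨΦ : ∀ x, Ψ x * Φ x = 1 := by
    have h : ∀ x, HasDerivAt (fun x => Ψ x * Φ x) 0 x := fun x => by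
      have := (hΨ' x).mul (hΦ' x)
      rwa [neg_mul, mul_assoc, neg_add_cancel] at this
    intro x
    have := is_const_of_deriv_eq_zero (fun x => (h x).differentiableAt) (fun x => (h x).deriv) x 0
    simpa [hΦ0, hΨ0] using this
  have hΦΨ : ∀ x, Φ x * Ψ x = 1 := fun x => by
    have h : (Ψ x : E →ₗ[ℂ] E) * (Φ x : E →ₗ[ℂ] E) = 1 := by
      have := congrArg (fun f : E →L[ℂ] E => (f : E →ₗ[ℂ] E)) (hΨΦ x)
      exact this
    have h' := mul_eq_one_comm.1 h
    ext v
    exact LinearMap.congr_fun h' v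
  refine ⟨fun x => ContinuousLinearEquiv.equivOfInverse (Φ x) (Ψ x)
    (fun v => DFunLike.congr_fun (hΨΦ x) v) (fun v => DFunLike.congr_fun (hΦΨ x) v),
    fun e x => ?_, fun ξ hξ => ⟨ξ 0, fun x => ?_⟩⟩
  · have := (hΦ' x).complex_clm_apply (hasDerivAt_const x e)
    rw [map_zero, add_zero] at this
    exact this
  · have h : ∀ x, HasDerivAt (fun x => Ψ x (ξ x)) 0 x := fun x => by
      have := (hΨ' x).complex_clm_apply (hξ x)
      simpa using this
    have hc := is_const_of_deriv_eq_zero (fun x => (h x).differentiableAt)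
      (fun x => (h x).deriv) x 0
    simp only [hΨ0, one_apply_eq_self] at hc
    change ξ x = Φ x (ξ 0)
    rw [← hc]
    exact (DFunLike.congr_fun (hΦΨ x) (ξ x)).symm

end Fundamental

/-! ### The gap metric and convergence of subspaces in terms of cones. -/

section Gap

variable {E : Type*} [NormedAddCommGroup E] [InnerProductSpace ℂ E] [FiniteDimensional ℂ E]

theorem norm_sub_starProjection_le (Y : Submodule ℂ E) (v : E) {y : E} (hy : y ∈ Y) :
    ‖v - Y.starProjection v‖ ≤ ‖v - y‖ := by
  rw [Y.starProjection_minimal v]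
  exact ciInf_le ⟨0, by rintro _ ⟨x, rfl⟩; exact norm_nonneg _⟩ (⟨y, hy⟩ : Y)

/-- Two subspaces of the same dimension are close as soon as the first is almost contained in the
second. -/
theorem norm_starProjection_sub_le {X Y : Submodule ℂ E}
    (hXY : Module.finrank ℂ X = Module.finrank ℂ Y) {s : ℝ} (hs0 : 0 ≤ s) (hs : s ≤ 1 / 2)
    (h : ∀ ξ ∈ X, ∃ y ∈ Y, ‖ξ - y‖ ≤ s * ‖ξ‖) :
    ‖X.starProjection - Y.starProjection‖ ≤ 3 * s := by
  have hX : ∀ ξ ∈ X, ‖ξ - Y.starProjection ξ‖ ≤ s * ‖ξ‖ := fun ξ hξ => by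
    obtain ⟨y, hy, hle⟩ := h ξ hξ
    exact (norm_sub_starProjection_le Y ξ hy).trans hle
  have hlow : ∀ ξ ∈ X, ‖ξ‖ ≤ 2 * ‖Y.starProjection ξ‖ := fun ξ hξ => by
    have h1 := hX ξ hξ
    have h2 := norm_le_norm_sub_add ξ (Y.starProjection ξ)
    nlinarith [norm_nonneg ξ]
  let p : X →ₗ[ℂ] Y := (Y.starProjection.toLinearMap.domRestrict X).codRestrict Y
    fun ξ => Y.starProjection_apply_mem _
  have hp : ∀ ξ : X, (p ξ : E) = Y.starProjection ξ := fun ξ => rfl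
  have hinj : Function.Injective p := by
    rw [← LinearMap.ker_eq_bot, LinearMap.ker_eq_bot']
    intro ξ hξ
    have h1 := hlow ξ ξ.2
    rw [← hp, hξ] at h1
    simpa using h1
  have hsurj : Function.Surjective p :=
    -- Equality of dimensions makes the one-sided closeness symmetric: every vector of `Y` is the
    -- projection of some vector of `X`.
    (LinearMap.injective_iff_surjective_of_finrank_eq_finrank hXY).1 hinj
  have hY : ∀ y ∈ Y, ‖y - X.starProjection y‖ ≤ 2 * s * ‖y‖ := fun y hy => by
    obtain ⟨ξ, hξ⟩ := hsurj ⟨y, hy⟩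
    have hξ' : Y.starProjection (ξ : E) = y := by rw [← hp, hξ]
    have h1 := hX ξ ξ.2
    have h2 := hlow ξ ξ.2
    rw [hξ'] at h1 h2
    calc ‖y - X.starProjection y‖ ≤ ‖y - ξ‖ := norm_sub_starProjection_le X y ξ.2
      _ = ‖(ξ : E) - y‖ := norm_sub_rev _ _
      _ ≤ s * ‖(ξ : E)‖ := h1
      _ ≤ 2 * s * ‖y‖ := by nlinarith
  refine ContinuousLinearMap.opNorm_le_bound _ (by positivity) fun v => ?_
  set w := v - X.starProjection v with hw
  have hwv : ‖w‖ ≤ ‖v‖ := by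
    simpa using norm_sub_starProjection_le X v X.zero_mem
  -- Duality: `w` is orthogonal to `X`, so pairing it with `q ∈ Y` only sees the small part `q - P_X
  -- q`. Together with the bound `s` on `X` this gives the total `3 s`.
  have hPw : ‖Y.starProjection w‖ ≤ 2 * s * ‖w‖ := by
    set q := Y.starProjection w with hq
    have h0 : inner ℂ (X.starProjection q) w = 0 := by
      rw [← inner_conj_symm, hw, X.starProjection_inner_eq_zero v _ (X.starProjection_apply_mem q),
        map_zero]
    have h1 : inner ℂ q q = inner ℂ (q - X.starProjection q) w := by
      rw [inner_sub_left, h0, sub_zero]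
      conv_lhs => rw [hq, Y.inner_starProjection_left_eq_right,
        Y.starProjection_eq_self_iff.2 (Y.starProjection_apply_mem w)]
      rw [hq, Y.inner_starProjection_left_eq_right]
    have h2 : ‖q‖ * ‖q‖ ≤ 2 * s * ‖q‖ * ‖w‖ := by
      have := norm_inner_le_norm (𝕜 := ℂ) (q - X.starProjection q) w
      rw [← h1, inner_self_eq_norm_sq_to_K] at this
      simp only [Complex.coe_algebraMap, norm_pow, Complex.norm_real, norm_norm] at this
      have h3 := hY q (Y.starProjection_apply_mem w)
      nlinarith [norm_nonneg w]
    rcases (norm_nonneg q).eq_or_lt with hq0 | hq0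
    · rw [← hq0]; positivity
    · nlinarith
  have hdec : (X.starProjection - Y.starProjection) v =
      (X.starProjection v - Y.starProjection (X.starProjection v)) - Y.starProjection w := by
    rw [hw, map_sub]
    simp
  rw [hdec]
  have h1 := hX _ (X.starProjection_apply_mem v)
  have h2 := X.norm_starProjection_apply_le v
  have h3 := norm_sub_le (X.starProjection v - Y.starProjection (X.starProjection v))
    (Y.starProjection w)
  nlinarith

variable {F : Type*} [NormedAddCommGroup F] [InnerProductSpace ℂ F]

theorem exists_coordinates [FiniteDimensional ℂ F]
    (hEF : Module.finrank ℂ E = Module.finrank ℂ F + Module.finrank ℂ F)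
    {U V : E →L[ℂ] F} {C : ℝ} (hC : ∀ ξ, ‖ξ‖ ≤ C * (‖U ξ‖ + ‖V ξ‖)) (u v : F) :
    ∃ ξ, U ξ = u ∧ V ξ = v := by
  have hinj : Function.Injective (U.toLinearMap.prod V.toLinearMap) := by
    rw [← LinearMap.ker_eq_bot, LinearMap.ker_eq_bot']
    intro ξ hξ
    have h1 : U ξ = 0 := congrArg Prod.fst hξ
    have h2 : V ξ = 0 := congrArg Prod.snd hξ
    simpa [h1, h2] using hC ξ
  obtain ⟨ξ, hξ⟩ := (LinearMap.injective_iff_surjective_of_finrank_eq_finrank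
    (by rw [Module.finrank_prod, hEF])).1 hinj (u, v)
  exact ⟨ξ, congrArg Prod.fst hξ, congrArg Prod.snd hξ⟩

theorem finrank_ker_of_coordinates [FiniteDimensional ℂ F]
    (hEF : Module.finrank ℂ E = Module.finrank ℂ F + Module.finrank ℂ F)
    {U V : E →L[ℂ] F} {C : ℝ} (hC : ∀ ξ, ‖ξ‖ ≤ C * (‖U ξ‖ + ‖V ξ‖)) :
    Module.finrank ℂ (LinearMap.ker V.toLinearMap) = Module.finrank ℂ F := by
  have hsurj : LinearMap.range V.toLinearMap = ⊤ := LinearMap.range_eq_top.2 fun v => by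
    obtain ⟨ξ, -, h⟩ := exists_coordinates hEF hC 0 v
    exact ⟨ξ, h⟩
  have := V.toLinearMap.finrank_range_add_finrank_ker
  rw [hsurj, finrank_top, hEF] at this
  omega

variable {α : Type*} {l : Filter α} {U V : α → E →L[ℂ] F} {U₀ V₀ : E →L[ℂ] F} {C : ℝ}
  {X : α → Submodule ℂ E}

/-- Subspaces contained in thinner and thinner cones around `ker V` converge to the limit of the
axes of these cones. -/
theorem tendsto_starProjection_ker [FiniteDimensional ℂ F]
    (hEF : Module.finrank ℂ E = Module.finrank ℂ F + Module.finrank ℂ F)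
    (hX : ∀ x, Module.finrank ℂ (X x) = Module.finrank ℂ F)
    (hU : Tendsto U l (𝓝 U₀)) (hV : Tendsto V l (𝓝 V₀))
    (hC : ∀ ξ, ‖ξ‖ ≤ C * (‖U₀ ξ‖ + ‖V₀ ξ‖))
    (h : ∀ e > 0, ∀ᶠ x in l, ∀ ξ ∈ X x, ‖V x ξ‖ ≤ e * ‖U x ξ‖) :
    Tendsto (fun x => (X x).starProjection) l
      (𝓝 (LinearMap.ker V₀.toLinearMap).starProjection) := by
  rw [tendsto_iff_norm_sub_tendsto_zero]
  have hmain : ∀ e > 0, ∀ᶠ x in l,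
      ‖(X x).starProjection - (LinearMap.ker V₀.toLinearMap).starProjection‖ ≤ e := by
    intro e he
    set s := min (e / 3) (1 / 2) with hs
    have hs0 : 0 < s := by positivity
    set D := |C| + 1 with hD
    have hD0 : 0 < D := by positivity
    set M := ‖U₀‖ + 1 with hM
    have hM0 : 0 < M := by positivity
    filter_upwards [h (s / (2 * D * M)) (by positivity),
      (tendsto_iff_norm_sub_tendsto_zero.1 hV).eventually_le_const
        (show 0 < s / (2 * D) by positivity),
      hU.norm.eventually_le_const (show ‖U₀‖ < M by linarith)] with x hx hVx hUx
    have := norm_starProjection_sub_le (X := X x) (Y := LinearMap.ker V₀.toLinearMap) (s := s)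
      (by rw [hX, finrank_ker_of_coordinates hEF hC]) hs0.le (min_le_right _ _) ?_
    · refine this.trans ?_
      linarith [min_le_left (e / 3) (1 / 2)]
    · intro ξ hξ
      -- The approximating vector is the projection of `ξ` onto `ker V₀` along `ker U₀`, so the
      -- error is controlled by `‖V₀ ξ‖` alone.
      obtain ⟨y, hy1, hy2⟩ := exists_coordinates hEF hC (U₀ ξ) 0
      refine ⟨y, hy2, ?_⟩
      have h1 := hC (ξ - y)
      simp only [map_sub, hy1, hy2, sub_self, norm_zero, sub_zero, zero_add] at h1
      have h2 : ‖V₀ ξ‖ ≤ ‖V x ξ‖ + ‖V x - V₀‖ * ‖ξ‖ := by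
        have h3 := (V x - V₀).le_opNorm ξ
        have h4 := norm_sub_le (V x ξ) ((V x - V₀) ξ)
        simp only [_root_.sub_apply, sub_sub_cancel] at h3 h4
        linarith
      have h3 : ‖V x ξ‖ ≤ s / (2 * D) * ‖ξ‖ := by
        refine (hx ξ hξ).trans ?_
        calc s / (2 * D * M) * ‖U x ξ‖ ≤ s / (2 * D * M) * (M * ‖ξ‖) := by
              gcongr
              exact ((U x).le_opNorm ξ).trans (by gcongr)
          _ = s / (2 * D) * ‖ξ‖ := by field_simp
      have h4 : ‖V₀ ξ‖ ≤ s / D * ‖ξ‖ := by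
        have : s / D = s / (2 * D) + s / (2 * D) := by field_simp; ring
        rw [this, add_mul]
        refine h2.trans (add_le_add h3 (by gcongr))
      calc ‖ξ - y‖ ≤ C * ‖V₀ ξ‖ := h1
        _ ≤ D * ‖V₀ ξ‖ := by gcongr; linarith [le_abs_self C]
        _ ≤ D * (s / D * ‖ξ‖) := by gcongr
        _ = s * ‖ξ‖ := by field_simp
  refine Metric.tendsto_nhds.2 fun e he => ?_
  filter_upwards [hmain (e / 2) (by positivity)] with x hx
  simp only [Real.dist_eq, sub_zero, abs_norm]
  linarith

/-- Subspaces converging to the limit of `ker V` are eventually contained in thin cones around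
`ker V`. -/
theorem eventually_cone_of_tendsto (hV : Tendsto V l (𝓝 V₀))
    (hC : ∀ x ξ, ‖ξ‖ ≤ C * (‖U x ξ‖ + ‖V x ξ‖))
    (h : Tendsto (fun x => (X x).starProjection) l
      (𝓝 (LinearMap.ker V₀.toLinearMap).starProjection)) {e : ℝ} (he : 0 < e) :
    ∀ᶠ x in l, ∀ ξ ∈ X x, ‖V x ξ‖ ≤ e * ‖U x ξ‖ := by
  set D := |C| + 1 with hD
  have hD0 : 0 < D := by positivity
  set M := ‖V₀‖ + 1 with hM
  have hM0 : 0 < M := by positivity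
  -- This leads to `‖V ξ‖ ≤ (min e 1 / 2) (‖U ξ‖ + ‖V ξ‖)`; the minimum with `1` allows the last
  -- term to be absorbed on the left.
  set s := min e 1 / (4 * D) with hs
  have hs0 : 0 < s := by positivity
  filter_upwards [(tendsto_iff_norm_sub_tendsto_zero.1 hV).eventually_le_const hs0,
    hV.norm.eventually_le_const (show ‖V₀‖ < M by linarith),
    (tendsto_iff_norm_sub_tendsto_zero.1 h).eventually_le_const
      (show 0 < s / M by positivity)] with x hVx hMx hPx ξ hξ
  set y := (LinearMap.ker V₀.toLinearMap).starProjection ξ with hy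
  have hy0 : V₀ y = 0 := (LinearMap.ker V₀.toLinearMap).starProjection_apply_mem ξ
  have hyn : ‖y‖ ≤ ‖ξ‖ := Submodule.norm_starProjection_apply_le _ ξ
  have h1 : ‖ξ - y‖ ≤ s / M * ‖ξ‖ := by
    have h3 := ((X x).starProjection - (LinearMap.ker V₀.toLinearMap).starProjection).le_opNorm ξ
    rw [_root_.sub_apply, (X x).starProjection_eq_self_iff.2 hξ] at h3
    exact h3.trans (by gcongr)
  have h2 : ‖V x ξ‖ ≤ 2 * s * ‖ξ‖ := by
    have hdec : V x ξ = V x (ξ - y) + (V x - V₀) y := by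
      simp [hy0]
    rw [hdec]
    refine (norm_add_le _ _).trans ?_
    have h3 : ‖V x (ξ - y)‖ ≤ M * (s / M * ‖ξ‖) :=
      ((V x).le_opNorm _).trans (mul_le_mul hMx h1 (norm_nonneg _) hM0.le)
    have h4 : ‖(V x - V₀) y‖ ≤ s * ‖ξ‖ :=
      ((V x - V₀).le_opNorm _).trans (mul_le_mul hVx hyn (norm_nonneg _) hs0.le)
    have h5 : M * (s / M * ‖ξ‖) = s * ‖ξ‖ := by field_simp
    linarith
  have h3 : ‖ξ‖ ≤ D * (‖U x ξ‖ + ‖V x ξ‖) :=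
    (hC x ξ).trans (by gcongr; linarith [le_abs_self C])
  have h4 : ‖V x ξ‖ ≤ min e 1 / 2 * (‖U x ξ‖ + ‖V x ξ‖) := by
    calc ‖V x ξ‖ ≤ 2 * s * ‖ξ‖ := h2
      _ ≤ 2 * s * (D * (‖U x ξ‖ + ‖V x ξ‖)) := by gcongr
      _ = min e 1 / 2 * (‖U x ξ‖ + ‖V x ξ‖) := by rw [hs]; field_simp; ring
  have h5 := min_le_left e 1
  have h6 := min_le_right e 1
  have h7 : min e 1 / 2 * ‖V x ξ‖ ≤ 1 / 2 * ‖V x ξ‖ := by gcongr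
  have h8 : min e 1 * ‖U x ξ‖ ≤ e * ‖U x ξ‖ := by gcongr
  linarith

end Gap

/-! ### Systems with separated growth rates and the invariance of cones. -/

section Split

variable {E F : Type*} [NormedAddCommGroup E] [InnerProductSpace ℂ E]
  [NormedAddCommGroup F] [InnerProductSpace ℂ F]

theorem hasDerivAt_norm_sq_re {f : ℝ → F} {f' : F} {x : ℝ} (hf : HasDerivAt f f' x) :
    HasDerivAt (fun x => ‖f x‖ ^ 2) (2 * (inner ℂ (f x) f').re) x := by
  let : InnerProductSpace ℝ F := InnerProductSpace.rclikeToReal ℂ F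
  exact hf.norm_sq

/-- Growth bounds for the two coordinates `U ξ`, `V ξ` of the solutions of `ξ' = B ξ`: up to a
coupling of size `ε`, the first one grows at least at rate `a`, the second one at most at rate
`b`. Here `U'` and `V'` are the derivatives of the coordinate maps. -/
def SplitBound (B : E →L[ℂ] E) (U V U' V' : E →L[ℂ] F) (ε a b : ℝ) : Prop :=
  ∀ ξ : E,
    a * ‖U ξ‖ ^ 2 - ε * ‖U ξ‖ * (‖U ξ‖ + ‖V ξ‖) ≤ (inner ℂ (U ξ) (U' ξ + U (B ξ))).re ∧
    (inner ℂ (V ξ) (V' ξ + V (B ξ))).re ≤ b * ‖V ξ‖ ^ 2 + ε * ‖V ξ‖ * (‖U ξ‖ + ‖V ξ‖)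

variable (E F) in
/-- A linear system `ξ' = B(x) ξ` on the line with coordinates `U(x) ξ`, `V(x) ξ` in which the
growth rates are separated, with a coupling bounded by `k s'`, where `s` increases from `0`
to `2`. -/
structure SplitSystem where
  B : ℝ → E →L[ℂ] E
  (U V U' V' : ℝ → E →L[ℂ] F)
  (Ubot Vbot Utop Vtop : E →L[ℂ] F)
  (s s' : ℝ → ℝ)
  (k C : ℝ)
  finrank_eq : Module.finrank ℂ E = Module.finrank ℂ F + Module.finrank ℂ F
  continuous_B : Continuous B
  k_pos : 0 < k
  s_mem : ∀ x, s x ∈ Ioo (0 : ℝ) 2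
  hasDerivAt_s : ∀ x, HasDerivAt s (s' x) x
  s'_nonneg : ∀ x, 0 ≤ s' x
  s_bot : Tendsto s atBot (𝓝 0)
  s_top : Tendsto s atTop (𝓝 2)
  s'_bot : Tendsto s' atBot (𝓝 0)
  s'_top : Tendsto s' atTop (𝓝 0)
  hasDerivAt_U : ∀ x, HasDerivAt U (U' x) x
  hasDerivAt_V : ∀ x, HasDerivAt V (V' x) x
  U_bot : Tendsto U atBot (𝓝 Ubot)
  V_bot : Tendsto V atBot (𝓝 Vbot)
  U_top : Tendsto U atTop (𝓝 Utop)
  V_top : Tendsto V atTop (𝓝 Vtop)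
  norm_le : ∀ x ξ, ‖ξ‖ ≤ C * (‖U x ξ‖ + ‖V x ξ‖)
  bound : ∀ x, ∃ a b, b < a ∧ SplitBound (B x) (U x) (V x) (U' x) (V' x) (k * s' x) a b
  bound_bot : ∃ a b, b < a ∧
    ∀ᶠ x in atBot, SplitBound (B x) (U x) (V x) (U' x) (V' x) (k * s' x) a b
  bound_top : ∃ a b, b < a ∧
    ∀ᶠ x in atTop, SplitBound (B x) (U x) (V x) (U' x) (V' x) (k * s' x) a b

theorem SplitBound.reverse {B : E →L[ℂ] E} {U V U' V' : E →L[ℂ] F} {ε a b : ℝ}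
    (h : SplitBound B U V U' V' ε a b) : SplitBound (-B) V U (-V') (-U') ε (-b) (-a) := by
  intro ξ
  obtain ⟨h1, h2⟩ := h ξ
  simp only [neg_apply, map_neg, ← neg_add, inner_neg_right, Complex.neg_re]
  constructor <;> linarith

/-- The system satisfied by `x ↦ ξ(-x)`, with the two coordinates exchanged. -/
def SplitSystem.reverse (S : SplitSystem E F) : SplitSystem E F where
  B x := -S.B (-x)
  U x := S.V (-x)
  V x := S.U (-x)
  U' x := -S.V' (-x)
  V' x := -S.U' (-x)
  Ubot := S.Vtop
  Vbot := S.Utop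
  Utop := S.Vbot
  Vtop := S.Ubot
  s x := 2 - S.s (-x)
  s' x := S.s' (-x)
  k := S.k
  C := S.C
  finrank_eq := S.finrank_eq
  continuous_B := (S.continuous_B.comp continuous_neg).neg
  k_pos := S.k_pos
  s_mem x := ⟨by linarith [(S.s_mem (-x)).2], by linarith [(S.s_mem (-x)).1]⟩
  hasDerivAt_s x := by
    have := ((S.hasDerivAt_s (-x)).scomp x (hasDerivAt_neg x)).const_sub 2
    simpa [Function.comp_def] using this
  s'_nonneg x := S.s'_nonneg _
  s_bot := by simpa using (S.s_top.comp tendsto_neg_atBot_atTop).const_sub 2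
  s_top := by simpa using (S.s_bot.comp tendsto_neg_atTop_atBot).const_sub 2
  s'_bot := S.s'_top.comp tendsto_neg_atBot_atTop
  s'_top := S.s'_bot.comp tendsto_neg_atTop_atBot
  hasDerivAt_U x := by
    simpa [Function.comp_def] using (S.hasDerivAt_V (-x)).scomp x (hasDerivAt_neg x)
  hasDerivAt_V x := by
    simpa [Function.comp_def] using (S.hasDerivAt_U (-x)).scomp x (hasDerivAt_neg x)
  U_bot := S.V_top.comp tendsto_neg_atBot_atTop
  V_bot := S.U_top.comp tendsto_neg_atBot_atTop
  U_top := S.V_bot.comp tendsto_neg_atTop_atBot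
  V_top := S.U_bot.comp tendsto_neg_atTop_atBot
  norm_le x ξ := by rw [add_comm]; exact S.norm_le (-x) ξ
  bound x := by
    obtain ⟨a, b, hab, h⟩ := S.bound (-x)
    exact ⟨-b, -a, neg_lt_neg hab, h.reverse⟩
  bound_bot := by
    obtain ⟨a, b, hab, h⟩ := S.bound_top
    exact ⟨-b, -a, neg_lt_neg hab,
      (tendsto_neg_atBot_atTop.eventually h).mono fun x hx => hx.reverse⟩
  bound_top := by
    obtain ⟨a, b, hab, h⟩ := S.bound_bot
    exact ⟨-b, -a, neg_lt_neg hab,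
      (tendsto_neg_atTop_atBot.eventually h).mono fun x hx => hx.reverse⟩

namespace SplitSystem

variable (S : SplitSystem E F)

/-- The growth bounds of the system at the point `x`. -/
def BoundAt (x a b : ℝ) : Prop :=
  SplitBound (S.B x) (S.U x) (S.V x) (S.U' x) (S.V' x) (S.k * S.s' x) a b

theorem norm_le_bot (ξ : E) : ‖ξ‖ ≤ S.C * (‖S.Ubot ξ‖ + ‖S.Vbot ξ‖) :=
  ge_of_tendsto
    ((((((ContinuousLinearMap.apply ℂ F ξ).continuous.tendsto S.Ubot).comp S.U_bot).norm).add
    (((ContinuousLinearMap.apply ℂ F ξ).continuous.tendsto S.Vbot).comp S.V_bot).norm).const_mul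
      S.C)
    (Eventually.of_forall fun x => S.norm_le x ξ)

theorem norm_le_top (ξ : E) : ‖ξ‖ ≤ S.C * (‖S.Utop ξ‖ + ‖S.Vtop ξ‖) :=
  ge_of_tendsto
    ((((((ContinuousLinearMap.apply ℂ F ξ).continuous.tendsto S.Utop).comp S.U_top).norm).add
    (((ContinuousLinearMap.apply ℂ F ξ).continuous.tendsto S.Vtop).comp S.V_top).norm).const_mul
      S.C)
    (Eventually.of_forall fun x => S.norm_le x ξ)

theorem eq_zero_of_coordinates {x : ℝ} {ξ : E} (hU : S.U x ξ = 0) (hV : S.V x ξ = 0) : ξ = 0 := by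
  simpa [hU, hV] using S.norm_le x ξ

theorem monotone_s : Monotone S.s :=
  monotone_of_deriv_nonneg (fun x => (S.hasDerivAt_s x).differentiableAt)
    fun x => by rw [(S.hasDerivAt_s x).deriv]; exact S.s'_nonneg x

theorem coupling_nonneg (x : ℝ) : 0 ≤ S.k * S.s' x := mul_nonneg S.k_pos.le (S.s'_nonneg x)

variable {S} {ξ : ℝ → E}

theorem hasDerivAt_norm_U (hξ : ∀ x, HasDerivAt ξ (S.B x (ξ x)) x) (x : ℝ) :
    HasDerivAt (fun x => ‖S.U x (ξ x)‖ ^ 2)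
    (2 * (inner ℂ (S.U x (ξ x)) (S.U' x (ξ x) + S.U x (S.B x (ξ x)))).re) x :=
  hasDerivAt_norm_sq_re ((S.hasDerivAt_U x).complex_clm_apply (hξ x))

theorem hasDerivAt_norm_V (hξ : ∀ x, HasDerivAt ξ (S.B x (ξ x)) x) (x : ℝ) :
    HasDerivAt (fun x => ‖S.V x (ξ x)‖ ^ 2)
    (2 * (inner ℂ (S.V x (ξ x)) (S.V' x (ξ x) + S.V x (S.B x (ξ x)))).re) x :=
  hasDerivAt_norm_sq_re ((S.hasDerivAt_V x).complex_clm_apply (hξ x))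

/-- A cone `‖V ξ‖ ≤ r ‖U ξ‖` is forward invariant if its opening `r(x)` satisfies the Riccati
differential inequality. -/
theorem cone_invariant (hξ : ∀ x, HasDerivAt ξ (S.B x (ξ x)) x)
    (hne : ∀ x, ξ x ≠ 0) {r r' : ℝ → ℝ} {x₀ x₁ : ℝ} (h01 : x₀ ≤ x₁)
    (hr : ∀ x ∈ Icc x₀ x₁, HasDerivAt r (r' x) x) (hpos : ∀ x ∈ Icc x₀ x₁, 0 < r x)
    (hgap : ∀ x ∈ Icc x₀ x₁, ∃ a b, S.BoundAt x a b ∧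
      S.k * S.s' x * (1 + r x) ^ 2 < r' x + (a - b) * r x)
    (h0 : ‖S.V x₀ (ξ x₀)‖ ≤ r x₀ * ‖S.U x₀ (ξ x₀)‖) :
    ‖S.V x₁ (ξ x₁)‖ ≤ r x₁ * ‖S.U x₁ (ξ x₁)‖ := by
  have hd : ∀ x ∈ Icc x₀ x₁, HasDerivAt
      (fun x => ‖S.V x (ξ x)‖ ^ 2 - r x ^ 2 * ‖S.U x (ξ x)‖ ^ 2)
      (2 * (inner ℂ (S.V x (ξ x)) (S.V' x (ξ x) + S.V x (S.B x (ξ x)))).re -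
        (2 * r x * r' x * ‖S.U x (ξ x)‖ ^ 2 + r x ^ 2 *
          (2 * (inner ℂ (S.U x (ξ x)) (S.U' x (ξ x) + S.U x (S.B x (ξ x)))).re))) x := by
    intro x hx
    have h1 : HasDerivAt (fun x => r x ^ 2) (2 * r x * r' x) x := by
      simpa using (hr x hx).fun_pow 2
    refine (hasDerivAt_norm_V hξ x).sub ((HasDerivAt.mul h1
      (hasDerivAt_norm_U hξ x)))
  -- The function `‖V ξ‖² - r² ‖U ξ‖²` need only have negative derivative where it vanishes, that is
  -- on the boundary of the cone.
  have hfin := image_le_of_deriv_right_lt_deriv_boundary' (B := fun _ => 0) (B' := fun _ => 0)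
    (fun x hx => (hd x hx).continuousAt.continuousWithinAt)
    (fun x hx => (hd x (Ico_subset_Icc_self hx)).hasDerivWithinAt)
    (by
      have := pow_le_pow_left₀ (norm_nonneg _) h0 2
      rw [mul_pow] at this
      linarith) continuousOn_const (fun x _ => hasDerivWithinAt_const x _ _)
    (fun x hx hx0 => ?_) (right_mem_Icc.2 h01)
  · have h1 := hpos x₁ (right_mem_Icc.2 h01)
    refine (sq_le_sq₀ (norm_nonneg _) (by positivity)).1 ?_
    rw [mul_pow]
    linarith
  · have hx' := Ico_subset_Icc_self hx
    obtain ⟨a, b, hab, hlt⟩ := hgap x hx'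
    have hrx := hpos x hx'
    obtain ⟨h1, h2⟩ := hab (ξ x)
    set u := ‖S.U x (ξ x)‖ with hu
    set v := ‖S.V x (ξ x)‖ with hv
    have hvu : v = r x * u := by
      have : v ^ 2 = (r x * u) ^ 2 := by rw [mul_pow]; linarith
      exact (pow_left_inj₀ (norm_nonneg _) (by positivity) two_ne_zero).1 this
    have hupos : 0 < u := by
      refine (norm_nonneg _).lt_of_ne fun h => hne x ?_
      have hu0 : u = 0 := h.symm
      refine S.eq_zero_of_coordinates (norm_eq_zero.1 hu0) (norm_eq_zero.1 ?_)
      rw [← hv, hvu, hu0, mul_zero]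
    -- Once `v = r u` is substituted, the derivative is at most the negative of this quantity.
    have h3 : 0 < 2 * r x * u ^ 2 * (r' x + (a - b) * r x - S.k * S.s' x * (1 + r x) ^ 2) := by
      have := sub_pos.2 hlt
      positivity
    have h4 : r x ^ 2 * (a * u ^ 2 - S.k * S.s' x * u * (u + v)) ≤ r x ^ 2 *
      (inner ℂ (S.U x (ξ x)) (S.U' x (ξ x) + S.U x (S.B x (ξ x)))).re := by gcongr
    rw [hvu] at h2 h4
    nlinarith

end SplitSystem
end Split

/-! ### Existence, uniqueness and forward limit of the solution space in thin cones at `-∞`. -/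

section SplitDynamics

variable {E F : Type*} [NormedAddCommGroup E] [InnerProductSpace ℂ E]
  [NormedAddCommGroup F] [InnerProductSpace ℂ F]

namespace SplitSystem

variable {S : SplitSystem E F} {ξ : ℝ → E}

/-- The opening `r = k s / (1 - k s)` has `1 + r = 1 / (1 - k s)` and `r' = k s' (1 + r)²`, so the
spectral gap alone gives strictness. Since `r` does not depend on `x₀`, the bound survives `x₀ →
-∞`. -/
theorem narrow_cone_invariant (hξ : ∀ x, HasDerivAt ξ (S.B x (ξ x)) x) (hne : ∀ x, ξ x ≠ 0)
    {x₀ x₁ : ℝ} (h01 : x₀ ≤ x₁) (h1 : S.k * S.s x₁ < 1) (h0 : S.V x₀ (ξ x₀) = 0) :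
    (1 - S.k * S.s x₁) * ‖S.V x₁ (ξ x₁)‖ ≤ S.k * S.s x₁ * ‖S.U x₁ (ξ x₁)‖ := by
  have hlt : ∀ x ∈ Icc x₀ x₁, 0 < 1 - S.k * S.s x := fun x hx => by
    have := mul_le_mul_of_nonneg_left (S.monotone_s hx.2) S.k_pos.le
    linarith
  have hks : ∀ x, 0 < S.k * S.s x := fun x => mul_pos S.k_pos (S.s_mem x).1
  have h := cone_invariant hξ hne (r := fun x => S.k * S.s x / (1 - S.k * S.s x))
    (r' := fun x => S.k * S.s' x / (1 - S.k * S.s x) ^ 2) h01 (fun x hx => by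
      have hd := (S.hasDerivAt_s x).const_mul S.k
      exact (hd.fun_div (hd.const_sub 1) (hlt x hx).ne').congr_deriv (by ring))
    (fun x hx => div_pos (hks x) (hlt x hx)) (fun x hx => by
      obtain ⟨a, b, hab, h⟩ := S.bound x
      refine ⟨a, b, h, ?_⟩
      have h2 : 1 + S.k * S.s x / (1 - S.k * S.s x) = 1 / (1 - S.k * S.s x) := by
        have := (hlt x hx).ne'
        field_simp
        ring
      have h3 : 0 < (a - b) * (S.k * S.s x / (1 - S.k * S.s x)) :=
        mul_pos (sub_pos.2 hab) (div_pos (hks x) (hlt x hx))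
      rw [h2, div_pow, one_pow, mul_one_div]
      linarith) (by
      rw [h0, norm_zero]
      exact mul_nonneg (div_pos (hks _) (hlt _ (left_mem_Icc.2 h01))).le (norm_nonneg _))
  have h2 := hlt x₁ (right_mem_Icc.2 h01)
  rw [div_mul_eq_mul_div, le_div_iff₀ h2] at h
  linarith

variable {Φ : ℝ → E ≃L[ℂ] E}

/-- The cone condition satisfied by the subspaces of solutions emanating from `ker V` at `-∞`. -/
def InNarrowCone (S : SplitSystem E F) (Φ : ℝ → E ≃L[ℂ] E) (X : Submodule ℂ E) : Prop :=
  ∀ e ∈ X, ∀ x, S.k * S.s x < 1 →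
    (1 - S.k * S.s x) * ‖S.V x (Φ x e)‖ ≤ S.k * S.s x * ‖S.U x (Φ x e)‖

/-- A compactness argument: orthonormal bases of the spaces of initial values whose solutions lie in
`ker V` at `-N` subconverge to an orthonormal family. At fixed `x` the cone condition is closed and
holds once `-N ≤ x`. -/
theorem exists_inNarrowCone [FiniteDimensional ℂ E] [FiniteDimensional ℂ F]
    (hΦ : ∀ e x, HasDerivAt (fun x => Φ x e) (S.B x (Φ x e)) x) :
    ∃ X : Submodule ℂ E, Module.finrank ℂ X = Module.finrank ℂ F ∧ S.InNarrowCone Φ X := by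
  set m := Module.finrank ℂ F with hm
  let X : ℕ → Submodule ℂ E := fun N =>
    (LinearMap.ker (S.V (-N)).toLinearMap).comap (Φ (-N) : E →ₗ[ℂ] E)
  have hX : ∀ N, Module.finrank ℂ (X N) = m := fun N => by
    rw [hm, ← finrank_ker_of_coordinates S.finrank_eq (S.norm_le (-N))]
    exact ((Φ (-N)).toLinearEquiv.ofSubmodule' _).finrank_eq
  have hcone : ∀ (N : ℕ), ∀ e ∈ X N, ∀ x, -(N : ℝ) ≤ x → S.k * S.s x < 1 →
      (1 - S.k * S.s x) * ‖S.V x (Φ x e)‖ ≤ S.k * S.s x * ‖S.U x (Φ x e)‖ := by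
    intro N e he x hx hx1
    rcases eq_or_ne e 0 with rfl | hne
    · simp
    · exact narrow_cone_invariant (hΦ e) (fun x => by simpa using hne) hx hx1 he
  let b : ∀ N, OrthonormalBasis (Fin m) ℂ (X N) := fun N =>
    (stdOrthonormalBasis ℂ (X N)).reindex (finCongr (hX N))
  let f : ℕ → Fin m → E := fun N j => (b N j : E)
  have hf : ∀ N, Orthonormal ℂ (f N) := fun N =>
    (b N).orthonormal.comp_linearIsometry (X N).subtypeₗᵢ
  have hK : IsCompact (Set.univ.pi fun _ : Fin m => Metric.closedBall (0 : E) 1) :=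
    isCompact_univ_pi fun _ => by
      have : ProperSpace E := FiniteDimensional.proper ℂ E
      exact isCompact_closedBall _ _
  obtain ⟨g, -, φ, hφ, hg⟩ := hK.tendsto_subseq (x := f) fun N j _ => by
    simp [(hf N).1 j]
  have hgj : ∀ j, Tendsto (fun N => f (φ N) j) atTop (𝓝 (g j)) := fun j =>
    (tendsto_pi_nhds.1 hg) j
  have hgo : Orthonormal ℂ g := by
    rw [orthonormal_iff_ite]
    intro i j
    refine tendsto_nhds_unique ((hgj i).inner (hgj j)) ?_
    simp_rw [orthonormal_iff_ite.1 (hf _) i j]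
    exact tendsto_const_nhds
  refine ⟨Submodule.span ℂ (range g), by
    simpa using finrank_span_eq_card hgo.linearIndependent, fun e he x hx => ?_⟩
  obtain ⟨c, rfl⟩ := (Submodule.mem_span_range_iff_exists_fun ℂ).1 he
  have hlim : Tendsto (fun N => ∑ j, c j • f (φ N) j) atTop (𝓝 (∑ j, c j • g j)) :=
    tendsto_finsetSum _ fun j _ => (hgj j).const_smul (c j)
  have hV : Tendsto (fun N => ‖S.V x (Φ x (∑ j, c j • f (φ N) j))‖) atTop
      (𝓝 ‖S.V x (Φ x (∑ j, c j • g j))‖) :=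
    ((((S.V x).continuous.comp (Φ x).continuous).norm).tendsto _).comp hlim
  have hU : Tendsto (fun N => ‖S.U x (Φ x (∑ j, c j • f (φ N) j))‖) atTop
      (𝓝 ‖S.U x (Φ x (∑ j, c j • g j))‖) :=
    ((((S.U x).continuous.comp (Φ x).continuous).norm).tendsto _).comp hlim
  refine le_of_tendsto_of_tendsto (hV.const_mul _) (hU.const_mul _) ?_
  have hN : Tendsto (fun N => ((φ N : ℕ) : ℝ)) atTop atTop :=
    tendsto_natCast_atTop_atTop.comp hφ.tendsto_atTop
  filter_upwards [hN.eventually_ge_atTop (-x)] with N hNx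
  exact hcone (φ N) _ (Submodule.sum_mem _ fun j _ => Submodule.smul_mem _ _ (b (φ N) j).2) x
    (by linarith) hx

theorem InNarrowCone.eventually_atBot {X : Submodule ℂ E} (hX : S.InNarrowCone Φ X) {e : ℝ}
    (he : 0 < e) : ∀ᶠ x in atBot, ∀ ξ ∈ X, ‖S.V x (Φ x ξ)‖ ≤ e * ‖S.U x (Φ x ξ)‖ := by
  have hks : Tendsto (fun x => S.k * S.s x) atBot (𝓝 0) := by
    simpa using S.s_bot.const_mul S.k
  filter_upwards [hks.eventually_le_const (show (0 : ℝ) < min (e / 2) (1 / 2) by positivity)]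
    with x hx ξ hξ
  have h1 := hx.trans (min_le_left _ _)
  have h2 := hx.trans (min_le_right _ _)
  have h3 := hX ξ hξ x (by linarith)
  nlinarith [norm_nonneg (S.V x (Φ x ξ)), norm_nonneg (S.U x (Φ x ξ))]

/-- Since `k s < 1/2`, the narrow cone lies in the unit cone at every `x`. Near `+∞` the gap `δ` is
uniform and the coupling vanishes, so the cone of opening `q + exp (-(δ/2) (x - x₀))` is invariant
and contains the unit cone at `x₀`. -/
theorem InNarrowCone.eventually_atTop
    (hΦ : ∀ e x, HasDerivAt (fun x => Φ x e) (S.B x (Φ x e)) x) (hk : S.k ≤ 1 / 4)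
    {X : Submodule ℂ E} (hX : S.InNarrowCone Φ X) {e : ℝ} (he : 0 < e) :
    ∀ᶠ x in atTop, ∀ ξ ∈ X, ‖S.V x (Φ x ξ)‖ ≤ e * ‖S.U x (Φ x ξ)‖ := by
  have hX1 : ∀ ξ ∈ X, ∀ x, ‖S.V x (Φ x ξ)‖ ≤ ‖S.U x (Φ x ξ)‖ := fun ξ hξ x => by
    have h1 : S.k * S.s x ≤ 1 / 2 := by
      nlinarith [(S.s_mem x).1, (S.s_mem x).2, S.k_pos]
    have h3 := hX ξ hξ x (by linarith)
    nlinarith [norm_nonneg (S.V x (Φ x ξ)), norm_nonneg (S.U x (Φ x ξ))]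
  obtain ⟨a, b, hab, hb⟩ := S.bound_top
  set δ := a - b with hδ
  have hδ0 : 0 < δ := sub_pos.2 hab
  set q := min (e / 2) 1 with hq
  have hq0 : 0 < q := by positivity
  have hks : Tendsto (fun x => S.k * S.s' x) atTop (𝓝 0) := by
    simpa using S.s'_top.const_mul S.k
  -- The `9` is `(1 + 2)²`, as the opening is at most `q + 1 ≤ 2`.
  obtain ⟨x₀, hx₀⟩ := Filter.eventually_atTop.1 (hb.and
    (hks.eventually_lt_const (show 0 < δ * q / 9 by positivity)))
  have hexp : Tendsto (fun x => Real.exp (-(δ / 2) * (x - x₀))) atTop (𝓝 0) := by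
    refine Real.tendsto_exp_atBot.comp (Tendsto.const_mul_atTop_of_neg (by linarith) ?_)
    exact tendsto_atTop_add_const_right _ _ tendsto_id
  filter_upwards [eventually_ge_atTop x₀, hexp.eventually_le_const (show 0 < e / 2 by positivity)]
    with x hx hxe ξ hξ
  rcases eq_or_ne ξ 0 with rfl | hne
  · simp
  have h := cone_invariant (hΦ ξ) (fun x => by simpa using hne)
    (r := fun x => q + Real.exp (-(δ / 2) * (x - x₀)))
    (r' := fun x => Real.exp (-(δ / 2) * (x - x₀)) * -(δ / 2)) hx (fun y hy => by
      have := (((hasDerivAt_id y).sub_const x₀).const_mul (-(δ / 2))).exp.const_add q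
      simpa using this) (fun y hy => by positivity) (fun y hy => by
      refine ⟨a, b, (hx₀ y hy.1).1, ?_⟩
      have h1 := (hx₀ y hy.1).2
      have h2 : Real.exp (-(δ / 2) * (y - x₀)) ≤ 1 := Real.exp_le_one_iff.2 (by
        nlinarith [hy.1])
      have h3 := Real.exp_pos (-(δ / 2) * (y - x₀))
      have hq1 : q ≤ 1 := min_le_right _ _
      have h4 : (1 + (q + Real.exp (-(δ / 2) * (y - x₀)))) ^ 2 ≤ 3 ^ 2 :=
        pow_le_pow_left₀ (by positivity) (by linarith) 2
      have h5 := mul_le_mul_of_nonneg_left h4 (S.coupling_nonneg y)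
      have h6 : 0 < δ * Real.exp (-(δ / 2) * (y - x₀)) := by positivity
      rw [← hδ]
      linarith) (by
      have := hX1 ξ hξ x₀
      simp only [sub_self, mul_zero, Real.exp_zero]
      nlinarith [norm_nonneg (S.U x₀ (Φ x₀ ξ))])
  refine h.trans ?_
  have := min_le_left (e / 2) 1
  gcongr
  linarith

/-- Where the coupling is at most `δ / 2`, solutions inside the cone `‖V ξ‖ ≤ ‖U ξ‖` decay
backwards at rate `a - δ`. -/
theorem monotoneOn_norm_U {ξ : ℝ → E} (hξ : ∀ x, HasDerivAt ξ (S.B x (ξ x)) x) {T a b δ : ℝ}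
    (hT : ∀ x ≤ T, S.BoundAt x a b ∧ S.k * S.s' x ≤ δ / 2)
    (hc : ∀ x ≤ T, ‖S.V x (ξ x)‖ ≤ ‖S.U x (ξ x)‖) :
    MonotoneOn (fun x => ‖S.U x (ξ x)‖ ^ 2 * Real.exp (-2 * (a - δ) * x)) (Iic T) := by
  have hd := fun x => (hasDerivAt_norm_U hξ x).mul
    (((hasDerivAt_id x).const_mul (-2 * (a - δ))).exp)
  refine monotoneOn_of_deriv_nonneg (convex_Iic T)
    (fun x _ => (hd x).continuousAt.continuousWithinAt)
    (fun x _ => (hd x).differentiableAt.differentiableWithinAt) fun x hx => ?_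
  rw [interior_Iic] at hx
  obtain ⟨h1, h2⟩ := hT x (le_of_lt hx)
  have h3 := hc x (le_of_lt hx)
  have h4 := S.coupling_nonneg x
  have h5 : 0 ≤ δ / 2 := h4.trans h2
  refine (hd x).deriv.ge.trans' ?_
  have h6 := (h1 (ξ x)).1
  set u := ‖S.U x (ξ x)‖
  set v := ‖S.V x (ξ x)‖
  have hu : 0 ≤ u := norm_nonneg _
  have h7 : S.k * S.s' x * u * (u + v) ≤ δ / 2 * u * (u + u) := by gcongr
  have h8 : 0 ≤ (inner ℂ (S.U x (ξ x)) (S.U' x (ξ x) + S.U x (S.B x (ξ x)))).re -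
      (a - δ) * u ^ 2 := by linarith
  have h9 := mul_nonneg h8 (Real.exp_pos (-2 * (a - δ) * x)).le
  simp only [id]
  linarith

/-- Solutions outside the cone `‖V ξ‖ ≤ ‖U ξ‖` grow backwards at rate `b + δ`. -/
theorem antitoneOn_norm_V {ξ : ℝ → E} (hξ : ∀ x, HasDerivAt ξ (S.B x (ξ x)) x) {T a b δ : ℝ}
    (hT : ∀ x ≤ T, S.BoundAt x a b ∧ S.k * S.s' x ≤ δ / 2)
    (hc : ∀ x ≤ T, ‖S.U x (ξ x)‖ ≤ ‖S.V x (ξ x)‖) :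
    AntitoneOn (fun x => ‖S.V x (ξ x)‖ ^ 2 * Real.exp (-2 * (b + δ) * x)) (Iic T) := by
  have hd := fun x => (hasDerivAt_norm_V hξ x).mul
    (((hasDerivAt_id x).const_mul (-2 * (b + δ))).exp)
  refine antitoneOn_of_deriv_nonpos (convex_Iic T)
    (fun x _ => (hd x).continuousAt.continuousWithinAt)
    (fun x _ => (hd x).differentiableAt.differentiableWithinAt) fun x hx => ?_
  rw [interior_Iic] at hx
  obtain ⟨h1, h2⟩ := hT x (le_of_lt hx)
  have h3 := hc x (le_of_lt hx)
  have h4 := S.coupling_nonneg x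
  have h5 : 0 ≤ δ / 2 := h4.trans h2
  refine (hd x).deriv.le.trans ?_
  have h6 := (h1 (ξ x)).2
  set u := ‖S.U x (ξ x)‖
  set v := ‖S.V x (ξ x)‖
  have hu : 0 ≤ u := norm_nonneg _
  have hv : 0 ≤ v := norm_nonneg _
  have h7 : S.k * S.s' x * v * (u + v) ≤ δ / 2 * v * (v + v) := by gcongr
  have h8 : 0 ≤ (b + δ) * v ^ 2 -
      (inner ℂ (S.V x (ξ x)) (S.V' x (ξ x) + S.V x (S.B x (ξ x)))).re := by linarith
  have h9 := mul_nonneg h8 (Real.exp_pos (-2 * (b + δ) * x)).le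
  simp only [id]
  linarith

/-- For `y ∈ Y \ X` choose `e ∈ X` with the same `U`-coordinate at `T`. Going backwards, `y - e`
stays outside the unit cone and obeys the `V`-rate, whereas `y` and `e` lie inside and obey the
`U`-rate; the gap makes this impossible. -/
theorem submodule_eq_of_eventually_atBot [FiniteDimensional ℂ E] [FiniteDimensional ℂ F]
    (hΦ : ∀ e x, HasDerivAt (fun x => Φ x e) (S.B x (Φ x e)) x)
    {X Y : Submodule ℂ E} (hX : Module.finrank ℂ X = Module.finrank ℂ F)
    (hY : Module.finrank ℂ Y = Module.finrank ℂ F)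
    (hXc : ∀ᶠ x in atBot, ∀ ξ ∈ X, ‖S.V x (Φ x ξ)‖ ≤ ‖S.U x (Φ x ξ)‖)
    (hYc : ∀ᶠ x in atBot, ∀ ξ ∈ Y, ‖S.V x (Φ x ξ)‖ ≤ ‖S.U x (Φ x ξ)‖) : X = Y := by
  obtain ⟨a, b, hab, hb⟩ := S.bound_bot
  set δ := a - b with hδ
  have hδ0 : 0 < δ := sub_pos.2 hab
  have hks : Tendsto (fun x => S.k * S.s' x) atBot (𝓝 0) := by
    simpa using S.s'_bot.const_mul S.k
  obtain ⟨T, hT⟩ := Filter.eventually_atBot.1 ((hXc.and hYc).and (hb.and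
    (hks.eventually_lt_const (show 0 < δ / 8 by positivity))))
  by_contra hne
  have hnot : ¬ Y ≤ X := fun h =>
    hne (Submodule.eq_of_le_of_finrank_eq h (by rw [hX, hY])).symm
  obtain ⟨y, hyY, hyX⟩ := SetLike.not_le_iff_exists.1 hnot
  -- The perturbed rates `a - δ/4` and `b + δ/4` still differ by `δ/2`; for squared norms this
  -- yields the factor `exp (δ x)`.
  have hgap : ∀ x ≤ T, S.BoundAt x a b ∧ S.k * S.s' x ≤ δ / 4 / 2 := fun x hx =>
    ⟨(hT x hx).2.1, by linarith [(hT x hx).2.2]⟩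
  obtain ⟨e, heX, heU⟩ : ∃ e ∈ X, S.U T (Φ T e) = S.U T (Φ T y) := by
    let p : X →ₗ[ℂ] F := ((S.U T).toLinearMap ∘ₗ (Φ T : E →ₗ[ℂ] E)).domRestrict X
    have hp : ∀ e : X, p e = S.U T (Φ T e) := fun e => rfl
    have hinj : Function.Injective p := by
      rw [← LinearMap.ker_eq_bot, LinearMap.ker_eq_bot']
      intro e he
      rw [hp] at he
      have h1 := (hT T le_rfl).1.1 e e.2
      rw [he, norm_zero, norm_le_zero_iff] at h1
      simpa using S.eq_zero_of_coordinates he h1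
    obtain ⟨e, he⟩ := (LinearMap.injective_iff_surjective_of_finrank_eq_finrank hX).1 hinj
      (S.U T (Φ T y))
    exact ⟨e, e.2, he⟩
  have hz : y - e ≠ 0 := fun h => hyX (by rwa [sub_eq_zero.1 h])
  have hzU : S.U T (Φ T (y - e)) = 0 := by simp [heU]
  have hzV : 0 < ‖S.V T (Φ T (y - e))‖ := norm_pos_iff.2 fun h =>
    hz ((Φ T).map_eq_zero_iff.1 (S.eq_zero_of_coordinates hzU h))
  -- Were `y - e` inside the unit cone at some earlier point, invariance would force its
  -- `V`-coordinate to vanish at `T` along with `U`.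
  have hzc : ∀ x ≤ T, ‖S.U x (Φ x (y - e))‖ ≤ ‖S.V x (Φ x (y - e))‖ := by
    intro x hx
    by_contra! hlt
    have h := cone_invariant (hΦ (y - e)) (fun x => (Φ x).map_ne_zero_iff.2 hz) (r := fun _ => 1)
      (r' := fun _ => 0) hx (fun x _ => hasDerivAt_const x _) (fun _ _ => one_pos)
      (fun t ht => ⟨a, b, (hT t ht.2).2.1, by linarith [(hT t ht.2).2.2]⟩) (by simpa using hlt.le)
    rw [hzU, norm_zero, mul_zero] at h
    linarith
  have hmy := monotoneOn_norm_U (hΦ y) hgap fun x hx => (hT x hx).1.2 y hyY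
  have hme := monotoneOn_norm_U (hΦ e) hgap fun x hx => (hT x hx).1.1 e heX
  have hmz := antitoneOn_norm_V (hΦ (y - e)) hgap hzc
  set M := 2 * (‖S.U T (Φ T y)‖ ^ 2 * Real.exp (-2 * (a - δ / 4) * T) +
    ‖S.U T (Φ T e)‖ ^ 2 * Real.exp (-2 * (a - δ / 4) * T)) with hM
  set m := ‖S.V T (Φ T (y - e))‖ ^ 2 * Real.exp (-2 * (b + δ / 4) * T) with hm
  have hm0 : 0 < m := by positivity
  have hle : ∀ x ≤ T, m ≤ M * Real.exp (δ * x) := by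
    intro x hx
    have h1 := hmy hx (mem_Iic.2 le_rfl) hx
    have h2 := hme hx (mem_Iic.2 le_rfl) hx
    have h3 := hmz hx (mem_Iic.2 le_rfl) hx
    simp only at h1 h2 h3
    refine h3.trans ?_
    have h4 : ‖S.V x (Φ x (y - e))‖ ^ 2 ≤ 2 * (‖S.U x (Φ x y)‖ ^ 2 + ‖S.U x (Φ x e)‖ ^ 2) := by
      have h5 : ‖S.V x (Φ x (y - e))‖ ≤ ‖S.U x (Φ x y)‖ + ‖S.U x (Φ x e)‖ := by
        rw [map_sub, map_sub]
        exact (norm_sub_le _ _).trans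
          (add_le_add ((hT x hx).1.2 y hyY) ((hT x hx).1.1 e heX))
      have h6 := pow_le_pow_left₀ (norm_nonneg _) h5 2
      nlinarith [sq_nonneg (‖S.U x (Φ x y)‖ - ‖S.U x (Φ x e)‖)]
    have hexp : Real.exp (-2 * (b + δ / 4) * x) =
        Real.exp (-2 * (a - δ / 4) * x) * Real.exp (δ * x) := by
      rw [← Real.exp_add, hδ]
      congr 1
      ring
    calc _ ≤ 2 * (‖S.U x (Φ x y)‖ ^ 2 + ‖S.U x (Φ x e)‖ ^ 2) *
          Real.exp (-2 * (b + δ / 4) * x) := by gcongr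
      _ = 2 * (‖S.U x (Φ x y)‖ ^ 2 * Real.exp (-2 * (a - δ / 4) * x) +
          ‖S.U x (Φ x e)‖ ^ 2 * Real.exp (-2 * (a - δ / 4) * x)) * Real.exp (δ * x) := by
        rw [hexp]; ring
      _ ≤ M * Real.exp (δ * x) := by rw [hM]; gcongr
  have hlim : Tendsto (fun x => M * Real.exp (δ * x)) atBot (𝓝 0) := by
    simpa using (Real.tendsto_exp_atBot.comp
      (Tendsto.const_mul_atBot hδ0 tendsto_id)).const_mul M
  exact absurd (ge_of_tendsto hlim ((eventually_le_atBot T).mono hle)) (not_le.2 hm0)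

end SplitSystem
end SplitDynamics

/-! ### From linear solutions to Grassmannian solutions. -/

section GrassSolutions

variable {ι : Type} [Fintype ι] {m : ℕ}

theorem Grass.isInducing_proj : IsInducing (Grass.proj : Grass ι m → _) := ⟨rfl⟩

theorem Grass.tendsto_iff {α : Type*} {l : Filter α} {X : α → Grass ι m} {Y : Grass ι m} :
    Tendsto X l (𝓝 Y) ↔ Tendsto (fun x => (X x).1.starProjection) l (𝓝 Y.1.starProjection) :=
  Grass.isInducing_proj.tendsto_nhds_iff

variable [DecidableEq ι] {M : ℝ → Matrix ι ι ℂ}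

/-- This reduces existence and uniqueness of a curve of subspaces to those of one subspace of
initial values, transported by the fundamental solution. -/
theorem isGrassSolution_iff {Φ : ℝ → EuclideanSpace ℂ ι ≃L[ℂ] EuclideanSpace ℂ ι}
    (hΦ : ∀ e x, HasDerivAt (fun x => Φ x e) (Matrix.toEuclideanCLM (𝕜 := ℂ) (M x) (Φ x e)) x)
    (hsol : ∀ ξ : ℝ → EuclideanSpace ℂ ι,
      (∀ x, HasDerivAt ξ (Matrix.toEuclideanCLM (𝕜 := ℂ) (M x) (ξ x)) x) → ∃ e, ∀ x, ξ x = Φ x e)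
    {X : ℝ → Grass ι m} :
    IsGrassSolution M X ↔ ∃ X₀ : Submodule ℂ (EuclideanSpace ℂ ι), Module.finrank ℂ X₀ = m ∧
      ∀ x, (X x).1 = X₀.map (Φ x : EuclideanSpace ℂ ι →ₗ[ℂ] EuclideanSpace ℂ ι) := by
  constructor
  · rintro ⟨ξ, hξ, hX⟩
    choose e he using fun j => hsol (ξ j) (hξ j)
    have hmap : ∀ x, (X x).1 = (Submodule.span ℂ (range e)).map
        (Φ x : EuclideanSpace ℂ ι →ₗ[ℂ] EuclideanSpace ℂ ι) := fun x => by
      rw [hX x, Submodule.map_span, ← range_comp]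
      congr 2
      funext j
      exact he j x
    refine ⟨_, ?_, hmap⟩
    have h := (X 0).2
    rw [hmap 0] at h
    exact (LinearEquiv.finrank_map_eq (Φ 0).toLinearEquiv _).symm.trans h
  · rintro ⟨X₀, hfin, hX⟩
    let b := Module.finBasisOfFinrankEq ℂ X₀ hfin
    refine ⟨fun j x => Φ x (b j), fun j x => hΦ _ x, fun x => ?_⟩
    have hb : Submodule.span ℂ (range fun j => (b j : EuclideanSpace ℂ ι)) = X₀ := by
      have h := congrArg (Submodule.map X₀.subtype) b.span_eq
      rw [Submodule.map_span, ← range_comp, Submodule.map_subtype_top] at h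
      exact h
    rw [hX x]
    conv_lhs => rw [← hb]
    rw [Submodule.map_span, ← range_comp]
    rfl

theorem IsGrassSolution.reverse {X : ℝ → Grass ι m} (hX : IsGrassSolution M X) :
    IsGrassSolution (fun x => -M (-x)) (fun x => X (-x)) := by
  obtain ⟨ξ, hξ, h⟩ := hX
  refine ⟨fun j x => ξ j (-x), fun j x => ?_, fun x => h (-x)⟩
  simpa [Function.comp_def] using (hξ j (-x)).scomp x (hasDerivAt_neg x)

variable {F : Type*} [NormedAddCommGroup F] [InnerProductSpace ℂ F] [FiniteDimensional ℂ F]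

namespace SplitSystem

variable {S : SplitSystem (EuclideanSpace ℂ ι) F}

/-- Convergence to `ker V` is equivalent to lying eventually in every thin cone around it, so the
cone lemmas apply. Only the forward limit needs `k` small. -/
theorem existsUnique_grassSolution (hm : Module.finrank ℂ F = m)
    (hM : ∀ x, S.B x = Matrix.toEuclideanCLM (𝕜 := ℂ) (M x)) {Y Z : Grass ι m}
    (hY : Y.1 = LinearMap.ker S.Vbot.toLinearMap) (hZ : Z.1 = LinearMap.ker S.Vtop.toLinearMap) :
    (∃! X : ℝ → Grass ι m, IsGrassSolution M X ∧ Tendsto X atBot (𝓝 Y)) ∧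
    (S.k ≤ 1 / 4 → ∀ X : ℝ → Grass ι m, IsGrassSolution M X → Tendsto X atBot (𝓝 Y) →
      Tendsto X atTop (𝓝 Z)) := by
  subst hm
  obtain ⟨Φ, hΦ, hsol⟩ := exists_fundamental_solution S.continuous_B
  have hiff := fun X => isGrassSolution_iff (m := Module.finrank ℂ F) (M := M) (Φ := Φ) (X := X)
    (fun e x => by simpa [hM] using hΦ e x) (fun ξ hξ => hsol ξ (by simpa [hM] using hξ))
  have hfin : ∀ (X₀ : Submodule ℂ (EuclideanSpace ℂ ι)) (x : ℝ), Module.finrank ℂ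
      (X₀.map (Φ x : EuclideanSpace ℂ ι →ₗ[ℂ] EuclideanSpace ℂ ι)) = Module.finrank ℂ X₀ :=
    fun X₀ x => LinearEquiv.finrank_map_eq (Φ x).toLinearEquiv _
  obtain ⟨X₀, hX₀, hcone⟩ := exists_inNarrowCone hΦ
  let Xm : ℝ → Grass ι (Module.finrank ℂ F) := fun x =>
    ⟨X₀.map (Φ x : EuclideanSpace ℂ ι →ₗ[ℂ] EuclideanSpace ℂ ι), by rw [hfin, hX₀]⟩
  have hXm : IsGrassSolution M Xm := (hiff Xm).2 ⟨X₀, hX₀, fun x => rfl⟩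
  have hbot : Tendsto Xm atBot (𝓝 Y) := by
    rw [Grass.tendsto_iff, hY]
    refine tendsto_starProjection_ker S.finrank_eq (fun x => (Xm x).2) S.U_bot S.V_bot
      S.norm_le_bot fun e he => ?_
    filter_upwards [hcone.eventually_atBot he] with x hx
    rintro _ ⟨ξ, hξ, rfl⟩
    exact hx ξ hξ
  have huniq : ∀ X, IsGrassSolution M X ∧ Tendsto X atBot (𝓝 Y) → X = Xm := by
    rintro X ⟨hX, hXY⟩
    obtain ⟨X₁, hX₁, hXmap⟩ := (hiff X).1 hX
    rw [Grass.tendsto_iff, hY] at hXY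
    have hev : ∀ᶠ x in atBot, ∀ ξ ∈ X₁, ‖S.V x (Φ x ξ)‖ ≤ ‖S.U x (Φ x ξ)‖ := by
      filter_upwards [eventually_cone_of_tendsto S.V_bot S.norm_le hXY one_pos] with x hx ξ hξ
      simpa using hx (Φ x ξ) (by rw [hXmap x]; exact ⟨ξ, hξ, rfl⟩)
    have heq : X₁ = X₀ := submodule_eq_of_eventually_atBot hΦ hX₁ hX₀ hev
      (by simpa using hcone.eventually_atBot one_pos)
    funext x
    exact Subtype.ext (by rw [hXmap x, heq])
  refine ⟨⟨Xm, ⟨hXm, hbot⟩, huniq⟩, fun hk X hX hXY => ?_⟩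
  rw [huniq X ⟨hX, hXY⟩, Grass.tendsto_iff, hZ]
  refine tendsto_starProjection_ker S.finrank_eq (fun x => (Xm x).2) S.U_top S.V_top
    S.norm_le_top fun e he => ?_
  filter_upwards [hcone.eventually_atTop hΦ hk he] with x hx
  rintro _ ⟨ξ, hξ, rfl⟩
  exact hx ξ hξ

theorem existsUnique_grassSolution_reverse (hm : Module.finrank ℂ F = m)
    (hM : ∀ x, S.B x = Matrix.toEuclideanCLM (𝕜 := ℂ) (M x)) {Y Z : Grass ι m}
    (hY : Y.1 = LinearMap.ker S.Utop.toLinearMap) (hZ : Z.1 = LinearMap.ker S.Ubot.toLinearMap) :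
    (∃! X : ℝ → Grass ι m, IsGrassSolution M X ∧ Tendsto X atTop (𝓝 Y)) ∧
    (S.k ≤ 1 / 4 → ∀ X : ℝ → Grass ι m, IsGrassSolution M X → Tendsto X atTop (𝓝 Y) →
      Tendsto X atBot (𝓝 Z)) := by
  obtain ⟨⟨X, ⟨hX, hXY⟩, huniq⟩, h2⟩ := existsUnique_grassSolution (S := S.reverse)
    (M := fun x => -M (-x)) hm (fun x => by simp [SplitSystem.reverse, hM]) hY hZ
  refine ⟨⟨fun x => X (-x), ⟨by simpa using hX.reverse, hXY.comp tendsto_neg_atTop_atBot⟩,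
    fun X' hX' => ?_⟩, fun hk X' hX' hXY' => ?_⟩
  · have := huniq _ ⟨hX'.1.reverse, hX'.2.comp tendsto_neg_atBot_atTop⟩
    rw [← this]
    simp
  · simpa [Function.comp_def] using (h2 hk _ hX'.reverse
      (hXY'.comp tendsto_neg_atBot_atTop)).comp tendsto_neg_atBot_atTop

end SplitSystem
end GrassSolutions

/-! ### Coordinates with respect to the columns of an invertible matrix. -/

section Halves

variable {n : ℕ}

/-- The restriction of the coordinates of a vector to the image of `f`. -/
noncomputable def coordRestrict {ι κ : Type} [Fintype ι] [Fintype κ] (f : κ → ι) :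
    EuclideanSpace ℂ ι →L[ℂ] EuclideanSpace ℂ κ :=
  LinearMap.toContinuousLinearMap
    { toFun := fun ζ => WithLp.toLp 2 fun i => ζ (f i)
      map_add' := fun _ _ => rfl
      map_smul' := fun _ _ => rfl }

/-- The first half of a vector of `ℂ^{2n}`. -/
noncomputable def firstHalf (n : ℕ) :
    EuclideanSpace ℂ (Fin n ⊕ Fin n) →L[ℂ] EuclideanSpace ℂ (Fin n) :=
  coordRestrict Sum.inl

/-- The last half of a vector of `ℂ^{2n}`. -/
noncomputable def lastHalf (n : ℕ) :
    EuclideanSpace ℂ (Fin n ⊕ Fin n) →L[ℂ] EuclideanSpace ℂ (Fin n) :=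
  coordRestrict Sum.inr

theorem firstHalf_apply (ζ : EuclideanSpace ℂ (Fin n ⊕ Fin n)) (i : Fin n) :
    firstHalf n ζ i = ζ (Sum.inl i) := rfl

theorem lastHalf_apply (ζ : EuclideanSpace ℂ (Fin n ⊕ Fin n)) (i : Fin n) :
    lastHalf n ζ i = ζ (Sum.inr i) := rfl

theorem norm_sq_eq_halves (ζ : EuclideanSpace ℂ (Fin n ⊕ Fin n)) :
    ‖ζ‖ ^ 2 = ‖firstHalf n ζ‖ ^ 2 + ‖lastHalf n ζ‖ ^ 2 := by
  simp [EuclideanSpace.norm_sq_eq, Fintype.sum_sum_type, firstHalf_apply, lastHalf_apply]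

theorem norm_firstHalf_le (ζ : EuclideanSpace ℂ (Fin n ⊕ Fin n)) : ‖firstHalf n ζ‖ ≤ ‖ζ‖ :=
  (sq_le_sq₀ (norm_nonneg _) (norm_nonneg _)).1 (by
    rw [norm_sq_eq_halves ζ]; nlinarith [sq_nonneg ‖lastHalf n ζ‖])

theorem norm_lastHalf_le (ζ : EuclideanSpace ℂ (Fin n ⊕ Fin n)) : ‖lastHalf n ζ‖ ≤ ‖ζ‖ :=
  (sq_le_sq₀ (norm_nonneg _) (norm_nonneg _)).1 (by
    rw [norm_sq_eq_halves ζ]; nlinarith [sq_nonneg ‖firstHalf n ζ‖])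

theorem norm_le_halves (ζ : EuclideanSpace ℂ (Fin n ⊕ Fin n)) :
    ‖ζ‖ ≤ ‖firstHalf n ζ‖ + ‖lastHalf n ζ‖ :=
  (sq_le_sq₀ (norm_nonneg _) (by positivity)).1 (by
    rw [norm_sq_eq_halves ζ]
    nlinarith [mul_nonneg (norm_nonneg (firstHalf n ζ)) (norm_nonneg (lastHalf n ζ))])

theorem firstHalf_fromBlocks (P Q : Matrix (Fin n) (Fin n) ℂ)
    (ζ : EuclideanSpace ℂ (Fin n ⊕ Fin n)) :
    firstHalf n (Matrix.toEuclideanCLM (𝕜 := ℂ) (Matrix.fromBlocks P 0 0 Q) ζ) =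
      Matrix.toEuclideanCLM (𝕜 := ℂ) P (firstHalf n ζ) := by
  ext i
  simp [firstHalf_apply, Matrix.ofLp_toEuclideanCLM, Matrix.mulVec, dotProduct,
    Fintype.sum_sum_type]

theorem lastHalf_fromBlocks (P Q : Matrix (Fin n) (Fin n) ℂ)
    (ζ : EuclideanSpace ℂ (Fin n ⊕ Fin n)) :
    lastHalf n (Matrix.toEuclideanCLM (𝕜 := ℂ) (Matrix.fromBlocks P 0 0 Q) ζ) =
      Matrix.toEuclideanCLM (𝕜 := ℂ) Q (lastHalf n ζ) := by
  ext i
  simp [lastHalf_apply, Matrix.ofLp_toEuclideanCLM, Matrix.mulVec, dotProduct,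
    Fintype.sum_sum_type]

/-- The first `n` coordinates with respect to the basis of the columns of `P`. -/
noncomputable def firstCoord (P : GL (Fin n ⊕ Fin n) ℂ) :
    EuclideanSpace ℂ (Fin n ⊕ Fin n) →L[ℂ] EuclideanSpace ℂ (Fin n) :=
  firstHalf n ∘L Matrix.toEuclideanCLM (𝕜 := ℂ) (P⁻¹).val

/-- The last `n` coordinates with respect to the basis of the columns of `P`. -/
noncomputable def lastCoord (P : GL (Fin n ⊕ Fin n) ℂ) :
    EuclideanSpace ℂ (Fin n ⊕ Fin n) →L[ℂ] EuclideanSpace ℂ (Fin n) :=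
  lastHalf n ∘L Matrix.toEuclideanCLM (𝕜 := ℂ) (P⁻¹).val

theorem toEuclideanCLM_inv_apply (P : GL (Fin n ⊕ Fin n) ℂ)
    (ξ : EuclideanSpace ℂ (Fin n ⊕ Fin n)) :
    Matrix.toEuclideanCLM (𝕜 := ℂ) P.val (Matrix.toEuclideanCLM (𝕜 := ℂ) (P⁻¹).val ξ) = ξ := by
  rw [← mul_apply_eq_comp, ← map_mul, Units.mul_inv, map_one]
  rfl

theorem norm_le_coord (P : GL (Fin n ⊕ Fin n) ℂ) (ξ : EuclideanSpace ℂ (Fin n ⊕ Fin n)) :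
    ‖ξ‖ ≤ ‖P.val‖ * (‖firstCoord P ξ‖ + ‖lastCoord P ξ‖) := by
  conv_lhs => rw [← toEuclideanCLM_inv_apply P ξ]
  refine (ContinuousLinearMap.le_opNorm _ _).trans ?_
  rw [Matrix.l2_opNorm_toEuclideanCLM]
  gcongr
  exact norm_le_halves _

theorem toEuclideanCLM_inv_colVec (P : GL (Fin n ⊕ Fin n) ℂ) (k : Fin n ⊕ Fin n) :
    Matrix.toEuclideanCLM (𝕜 := ℂ) (P⁻¹).val (colVec P.val k) =
      WithLp.toLp 2 (Pi.single k 1) := by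
  have h : colVec P.val k =
      Matrix.toEuclideanCLM (𝕜 := ℂ) P.val (WithLp.toLp 2 (Pi.single k 1)) := by
    rw [Matrix.toEuclideanCLM_toLp, Matrix.mulVec_single_one]
    rfl
  rw [h, ← mul_apply_eq_comp, ← map_mul, Units.inv_mul, map_one]
  rfl

theorem finrank_halves : Module.finrank ℂ (EuclideanSpace ℂ (Fin n ⊕ Fin n)) =
    Module.finrank ℂ (EuclideanSpace ℂ (Fin n)) + Module.finrank ℂ (EuclideanSpace ℂ (Fin n)) := by
  simp

theorem spanFirst_eq_ker (P : GL (Fin n ⊕ Fin n) ℂ) :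
    (spanFirst P).1 = LinearMap.ker (lastCoord P).toLinearMap := by
  refine Submodule.eq_of_le_of_finrank_eq (Submodule.span_le.2 ?_) ?_
  · rintro _ ⟨j, rfl⟩
    change lastHalf n (Matrix.toEuclideanCLM (𝕜 := ℂ) (P⁻¹).val (colVec P.val (Sum.inl j))) = 0
    rw [toEuclideanCLM_inv_colVec]
    ext i
    simp [lastHalf_apply]
  · rw [finrank_ker_of_coordinates finrank_halves (norm_le_coord P), (spanFirst P).2]
    simp

theorem spanLast_eq_ker (P : GL (Fin n ⊕ Fin n) ℂ) :
    (spanLast P).1 = LinearMap.ker (firstCoord P).toLinearMap := by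
  refine Submodule.eq_of_le_of_finrank_eq (Submodule.span_le.2 ?_) ?_
  · rintro _ ⟨j, rfl⟩
    change firstHalf n (Matrix.toEuclideanCLM (𝕜 := ℂ) (P⁻¹).val (colVec P.val (Sum.inr j))) = 0
    rw [toEuclideanCLM_inv_colVec]
    ext i
    simp [firstHalf_apply]
  · rw [finrank_ker_of_coordinates finrank_halves
      (fun ξ => (norm_le_coord P ξ).trans_eq (by rw [add_comm])), (spanLast P).2]
    simp

end Halves

/-! ### Limits of `χ` at both ends. -/

section Equilibria

/-- For `χ ≥ 0` one has `1 - χ² ≥ 1 - χ`, so `1 - χ` decays at least at the exponential rate `h₀`.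
-/
theorem tendsto_one_of_logistic {h χ : ℝ → ℝ} {h₀ : ℝ} (hh₀ : 0 < h₀)
    (hh : ∀ τ ∈ Icc (-1 : ℝ) 1, h₀ ≤ h τ) (hχ : ∀ x, χ x ∈ Ioo (-1 : ℝ) 1)
    (hχd : ∀ x, HasDerivAt χ ((1 - χ x ^ 2) * h (χ x)) x) (hχ0 : χ 0 = 0) :
    Tendsto χ atTop (𝓝 1) := by
  have hpos : ∀ x, 0 < 1 - χ x ^ 2 := fun x => by nlinarith [(hχ x).1, (hχ x).2]
  have hmono : Monotone χ := monotone_of_deriv_nonneg (fun x => (hχd x).differentiableAt)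
    fun x => by
      rw [(hχd x).deriv]
      exact mul_nonneg (hpos x).le (hh₀.le.trans (hh _ (Ioo_subset_Icc_self (hχ x))))
  have hd := fun x => ((hχd x).const_sub 1).mul (((hasDerivAt_id x).const_mul h₀).exp)
  have hanti : AntitoneOn (fun x => (1 - χ x) * Real.exp (h₀ * x)) (Ici 0) := by
    refine antitoneOn_of_deriv_nonpos (convex_Ici 0)
      (fun x _ => (hd x).continuousAt.continuousWithinAt)
      (fun x _ => (hd x).differentiableAt.differentiableWithinAt) fun x hx => ?_
    rw [interior_Ici] at hx
    refine (hd x).deriv.le.trans ?_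
    have h0 : 0 ≤ χ x := by rw [← hχ0]; exact hmono (le_of_lt hx)
    have h1 := hh _ (Ioo_subset_Icc_self (hχ x))
    have h2 : (1 - χ x) * h₀ ≤ (1 - χ x ^ 2) * h (χ x) :=
      mul_le_mul (by nlinarith [(hχ x).2]) h1 hh₀.le (hpos x).le
    have h3 := mul_nonneg (sub_nonneg.2 h2) (Real.exp_pos (h₀ * x)).le
    simp only [id]
    linarith
  have hup : ∀ x ∈ Ici (0 : ℝ), 1 - Real.exp (-h₀ * x) ≤ χ x := fun x hx => by
    have h1 := hanti (mem_Ici.2 le_rfl) hx hx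
    simp only [hχ0, mul_zero, Real.exp_zero, sub_zero, mul_one] at h1
    rw [neg_mul, Real.exp_neg]
    have h2 := (le_div_iff₀ (Real.exp_pos (h₀ * x))).2 h1
    rw [one_div] at h2
    linarith
  have hlim : Tendsto (fun x => 1 - Real.exp (-h₀ * x)) atTop (𝓝 1) := by
    simpa using (Real.tendsto_exp_atBot.comp
      (Tendsto.const_mul_atTop_of_neg (neg_lt_zero.2 hh₀) tendsto_id)).const_sub 1
  exact tendsto_of_tendsto_of_tendsto_of_le_of_le' hlim tendsto_const_nhds
    ((eventually_ge_atTop 0).mono hup) (Eventually.of_forall fun x => (hχ x).2.le)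

theorem tendsto_neg_one_of_logistic {h χ : ℝ → ℝ} {h₀ : ℝ} (hh₀ : 0 < h₀)
    (hh : ∀ τ ∈ Icc (-1 : ℝ) 1, h₀ ≤ h τ) (hχ : ∀ x, χ x ∈ Ioo (-1 : ℝ) 1)
    (hχd : ∀ x, HasDerivAt χ ((1 - χ x ^ 2) * h (χ x)) x) (hχ0 : χ 0 = 0) :
    Tendsto χ atBot (𝓝 (-1)) := by
  have := tendsto_one_of_logistic (h := fun τ => h (-τ)) (χ := fun x => -χ (-x)) hh₀
    (fun τ hτ => hh _ ⟨by linarith [hτ.2], by linarith [hτ.1]⟩)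
    (fun x => ⟨by linarith [(hχ (-x)).2], by linarith [(hχ (-x)).1]⟩)
    (fun x => by simpa [Function.comp_def] using ((hχd (-x)).scomp x (hasDerivAt_neg x)).fun_neg)
    (by simp [hχ0])
  simpa [Function.comp_def] using (this.comp tendsto_neg_atBot_atTop).neg

end Equilibria

/-! ### The block-diagonalized system as a split system. -/

section Concrete

variable {n : ℕ}

/-- The definiteness bounds of the two diagonal blocks. -/
def FormBound (P Q : Matrix (Fin n) (Fin n) ℂ) (a b : ℝ) : Prop :=
  ∀ η : EuclideanSpace ℂ (Fin n),
    a * ‖η‖ ^ 2 ≤ (inner ℂ η (Matrix.toEuclideanCLM (𝕜 := ℂ) P η)).re ∧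
    (inner ℂ η (Matrix.toEuclideanCLM (𝕜 := ℂ) Q η)).re ≤ b * ‖η‖ ^ 2

theorem abs_re_inner_toEuclideanCLM_sub_le (P P' : Matrix (Fin n) (Fin n) ℂ)
    (η : EuclideanSpace ℂ (Fin n)) :
    |(inner ℂ η (Matrix.toEuclideanCLM (𝕜 := ℂ) P η)).re -
      (inner ℂ η (Matrix.toEuclideanCLM (𝕜 := ℂ) P' η)).re| ≤ ‖P - P'‖ * ‖η‖ ^ 2 := by
  rw [← Complex.sub_re, ← inner_sub_right, ← _root_.sub_apply, ← map_sub]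
  refine (Complex.abs_re_le_norm _).trans ((norm_inner_le_norm _ _).trans ?_)
  have := (Matrix.toEuclideanCLM (𝕜 := ℂ) (P - P')).le_opNorm η
  rw [Matrix.l2_opNorm_toEuclideanCLM] at this
  nlinarith [norm_nonneg η]

/-- The bounds `cgt` and `clt` need not be continuous, so a uniform gap near an end point comes from
the end point itself and the continuity of the blocks. Each rate gives up a quarter of the gap. -/
theorem FormBound.eventually {P Q : ℝ → Matrix (Fin n) (Fin n) ℂ} {l : Filter ℝ}
    {P₀ Q₀ : Matrix (Fin n) (Fin n) ℂ} {a b : ℝ} (hab : b < a) (h : FormBound P₀ Q₀ a b)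
    (hP : Tendsto P l (𝓝 P₀)) (hQ : Tendsto Q l (𝓝 Q₀)) :
    ∃ a' b', b' < a' ∧ ∀ᶠ x in l, FormBound (P x) (Q x) a' b' := by
  refine ⟨a - (a - b) / 4, b + (a - b) / 4, by linarith, ?_⟩
  have hδ : 0 < (a - b) / 4 := by linarith
  filter_upwards [(tendsto_iff_norm_sub_tendsto_zero.1 hP).eventually_le_const hδ,
    (tendsto_iff_norm_sub_tendsto_zero.1 hQ).eventually_le_const hδ] with x hPx hQx η
  have h1 := abs_le.1 (abs_re_inner_toEuclideanCLM_sub_le (P x) P₀ η)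
  have h2 := abs_le.1 (abs_re_inner_toEuclideanCLM_sub_le (Q x) Q₀ η)
  have h3 := mul_le_mul_of_nonneg_right hPx (sq_nonneg ‖η‖)
  have h4 := mul_le_mul_of_nonneg_right hQx (sq_nonneg ‖η‖)
  obtain ⟨h5, h6⟩ := h η
  constructor <;> linarith [h1.1, h2.2]

/-- Composition of the operator of a matrix with the linear map `p`, as a function of the matrix. -/
noncomputable def compToEuclideanCLM {ι κ : Type} [Fintype ι] [DecidableEq ι] [Fintype κ]
    (p : EuclideanSpace ℂ ι →L[ℂ] EuclideanSpace ℂ κ) :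
    Matrix ι ι ℂ →L[ℝ] (EuclideanSpace ℂ ι →L[ℂ] EuclideanSpace ℂ κ) :=
  LinearMap.mkContinuous
    { toFun := fun M => p ∘L Matrix.toEuclideanCLM (𝕜 := ℂ) M
      map_add' := fun M N => by rw [map_add, ContinuousLinearMap.comp_add]
      map_smul' := fun c M => by
        refine ContinuousLinearMap.ext fun v => ?_
        change p (Matrix.toEuclideanCLM (𝕜 := ℂ) ((c : ℂ) • M) v) =
          (c : ℂ) • p (Matrix.toEuclideanCLM (𝕜 := ℂ) M v)
        rw [map_smul (Matrix.toEuclideanCLM (𝕜 := ℂ)), smul_apply, map_smul] } ‖p‖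
    fun M => (p.opNorm_comp_le _).trans_eq (by rw [Matrix.l2_opNorm_toEuclideanCLM])

/-- With `(R⁻¹)' = -σ R⁻¹ R' R⁻¹`, the vector `ζ = R⁻¹ ξ` has derivative `R⁻¹ A R ζ - σ R⁻¹ R' ζ`;
the first term is block diagonal and the second is the coupling. Here `σ` stands for `χ'`. -/
theorem splitBound_of_formBound {A R : GL (Fin n ⊕ Fin n) ℂ}
    {R' : Matrix (Fin n ⊕ Fin n) (Fin n ⊕ Fin n) ℂ} {P Q : Matrix (Fin n) (Fin n) ℂ}
    (hblock : (R⁻¹ * A * R : GL (Fin n ⊕ Fin n) ℂ).val = Matrix.fromBlocks P 0 0 Q)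
    {k σ a b : ℝ} (hσ : 0 ≤ σ) (hk : ‖(R⁻¹).val * R'‖ ≤ k) (h : FormBound P Q a b) :
    SplitBound (Matrix.toEuclideanCLM (𝕜 := ℂ) A.val) (firstCoord R) (lastCoord R)
      (firstHalf n ∘L
        Matrix.toEuclideanCLM (𝕜 := ℂ) (σ • -((R⁻¹).val * R' * (R⁻¹).val)))
      (lastHalf n ∘L
        Matrix.toEuclideanCLM (𝕜 := ℂ) (σ • -((R⁻¹).val * R' * (R⁻¹).val)))
      (k * σ) a b := by
  intro ξ
  set ζ := Matrix.toEuclideanCLM (𝕜 := ℂ) (R⁻¹).val ξ with hζ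
  set γ := Matrix.toEuclideanCLM (𝕜 := ℂ) ((R⁻¹).val * R') ζ with hγ
  have hγn : ‖γ‖ ≤ k * (‖firstHalf n ζ‖ + ‖lastHalf n ζ‖) := by
    refine (ContinuousLinearMap.le_opNorm _ _).trans ?_
    rw [Matrix.l2_opNorm_toEuclideanCLM]
    exact mul_le_mul hk (norm_le_halves ζ) (norm_nonneg _) ((norm_nonneg _).trans hk)
  have hd : Matrix.toEuclideanCLM (𝕜 := ℂ) (σ • -((R⁻¹).val * R' * (R⁻¹).val)) ξ =
      -((σ : ℂ) • γ) := by
    have : σ • -((R⁻¹).val * R' * (R⁻¹).val) = -((σ : ℂ) • ((R⁻¹).val * R' * (R⁻¹).val)) := by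
      rw [smul_neg]; rfl
    rw [this, map_neg, map_smul, map_mul]
    rfl
  have hB : Matrix.toEuclideanCLM (𝕜 := ℂ) (R⁻¹).val (Matrix.toEuclideanCLM (𝕜 := ℂ) A.val ξ) =
      Matrix.toEuclideanCLM (𝕜 := ℂ) (Matrix.fromBlocks P 0 0 Q) ζ := by
    rw [← hblock, hζ, ← mul_apply_eq_comp, ← mul_apply_eq_comp, ← map_mul, ← map_mul]
    congr 2
    rw [← Units.val_mul, ← Units.val_mul, mul_assoc _ R R⁻¹, mul_inv_cancel, mul_one]
  have hinner : ∀ (u w : EuclideanSpace ℂ (Fin n)) (q : EuclideanSpace ℂ (Fin n)), ‖q‖ ≤ ‖γ‖ →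
      |(inner ℂ u (-((σ : ℂ) • q) + w)).re - (inner ℂ u w).re| ≤
        k * σ * ‖u‖ * (‖firstHalf n ζ‖ + ‖lastHalf n ζ‖) := by
    intro u w q hq
    rw [inner_add_right, Complex.add_re, add_sub_cancel_right]
    refine (Complex.abs_re_le_norm _).trans ((norm_inner_le_norm _ _).trans ?_)
    rw [norm_neg, norm_smul, Complex.norm_real, Real.norm_of_nonneg hσ]
    calc ‖u‖ * (σ * ‖q‖) ≤ ‖u‖ * (σ * (k * (‖firstHalf n ζ‖ + ‖lastHalf n ζ‖))) := by
          gcongr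
          exact hq.trans hγn
      _ = _ := by ring
  have h1 := abs_le.1 (hinner (firstHalf n ζ)
    (Matrix.toEuclideanCLM (𝕜 := ℂ) P (firstHalf n ζ)) (firstHalf n γ) (norm_firstHalf_le γ))
  have h2 := abs_le.1 (hinner (lastHalf n ζ)
    (Matrix.toEuclideanCLM (𝕜 := ℂ) Q (lastHalf n ζ)) (lastHalf n γ) (norm_lastHalf_le γ))
  simp only [firstCoord, lastCoord, ContinuousLinearMap.comp_apply, hd, hB, ← hζ,
    firstHalf_fromBlocks, lastHalf_fromBlocks, map_neg, map_smul]
  have h3 := (h (firstHalf n ζ)).1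
  have h4 := (h (lastHalf n ζ)).2
  constructor <;> linarith [h1.1, h2.2]

variable {cgt clt : ℝ → ℝ} {A R : ℝ → GL (Fin n ⊕ Fin n) ℂ}
  {Agt Alt : ℝ → Matrix (Fin n) (Fin n) ℂ} {h χ : ℝ → ℝ}

namespace BlockData

theorem formBound (D : BlockData cgt clt A R Agt Alt) {τ : ℝ} (hτ : τ ∈ Icc (-1 : ℝ) 1) :
    FormBound (Agt τ) (Alt τ) (cgt τ) (-clt τ) :=
  fun η => ⟨D.gt τ hτ η, D.lt τ hτ η⟩

theorem continuousOn_inv (D : BlockData cgt clt A R Agt Alt) :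
    ContinuousOn (fun τ => ((R τ)⁻¹).val) (Icc (-1 : ℝ) 1) := by
  intro τ hτ
  have h := (NormedRing.inverse_continuousAt (R τ)).comp_continuousWithinAt
    (f := fun τ => (R τ).val) (D.smooth_R.continuousOn τ hτ)
  simpa [Function.comp_def] using h

theorem continuousOn_conj (D : BlockData cgt clt A R Agt Alt) :
    ContinuousOn (fun τ => Matrix.fromBlocks (Agt τ) 0 0 (Alt τ)) (Icc (-1 : ℝ) 1) := by
  refine ((D.continuousOn_inv.mul D.smooth_A.continuousOn).mul D.smooth_R.continuousOn).congr
    fun τ hτ => ?_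
  exact (D.block τ hτ).symm

theorem continuousOn_Agt (D : BlockData cgt clt A R Agt Alt) :
    ContinuousOn Agt (Icc (-1 : ℝ) 1) := by
  have h : Continuous fun M : Matrix (Fin n ⊕ Fin n) (Fin n ⊕ Fin n) ℂ =>
    M.submatrix Sum.inl Sum.inl := continuous_id.matrix_submatrix _ _
  exact h.comp_continuousOn D.continuousOn_conj

theorem continuousOn_Alt (D : BlockData cgt clt A R Agt Alt) :
    ContinuousOn Alt (Icc (-1 : ℝ) 1) := by
  have h : Continuous fun M : Matrix (Fin n ⊕ Fin n) (Fin n ⊕ Fin n) ℂ =>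
    M.submatrix Sum.inr Sum.inr := continuous_id.matrix_submatrix _ _
  exact h.comp_continuousOn D.continuousOn_conj

theorem hasDerivWithinAt_R (D : BlockData cgt clt A R Agt Alt) {τ : ℝ} (hτ : τ ∈ Icc (-1 : ℝ) 1) :
    HasDerivWithinAt (fun s => (R s).val) (derivWithin (fun s => (R s).val) (Icc (-1) 1) τ)
      (Icc (-1) 1) τ :=
  ((D.smooth_R.differentiableOn (by simp)) τ hτ).hasDerivWithinAt

theorem hasDerivAt_inv (D : BlockData cgt clt A R Agt Alt) {σ x : ℝ}
    (hχ : χ x ∈ Ioo (-1 : ℝ) 1) (hχd : HasDerivAt χ σ x) :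
    HasDerivAt (fun x => ((R (χ x))⁻¹).val)
      (σ • -(((R (χ x))⁻¹).val * derivWithin (fun s => (R s).val) (Icc (-1) 1) (χ x) *
        ((R (χ x))⁻¹).val)) x := by
  have h1 := (D.hasDerivWithinAt_R (Ioo_subset_Icc_self hχ)).hasDerivAt (Icc_mem_nhds hχ.1 hχ.2)
  have h2 := (hasFDerivAt_ringInverse (𝕜 := ℝ) (R (χ x))).comp_hasDerivAt (χ x) h1
  have h3 := h2.scomp x hχd
  simpa [Function.comp_def] using h3

theorem exists_norm_inv_mul_deriv_le (D : BlockData cgt clt A R Agt Alt) :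
    ∃ k, 0 < k ∧ ∀ τ ∈ Icc (-1 : ℝ) 1,
      ‖((R τ)⁻¹).val * derivWithin (fun s => (R s).val) (Icc (-1) 1) τ‖ ≤ k := by
  obtain ⟨k, hk⟩ := isCompact_Icc.exists_bound_of_continuousOn (s := Icc (-1 : ℝ) 1)
    (D.continuousOn_inv.mul (D.smooth_R.continuousOn_derivWithin
      (uniqueDiffOn_Icc (by norm_num)) (by simp)))
  exact ⟨|k| + 1, by positivity, fun τ hτ => (hk τ hτ).trans (by linarith [le_abs_self k])⟩

/-- The mean value inequality puts `R(0)⁻¹ R(τ)` within `1/10` of the identity, so replacing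
`R(0)⁻¹` by `R(τ)⁻¹` costs little: `‖Z‖ ≤ 1/10 + ‖Z‖/10` gives `‖Z‖ ≤ 1/9`. -/
theorem norm_inv_mul_deriv_le_of_le (D : BlockData cgt clt A R Agt Alt)
    (hc : ∀ τ ∈ Icc (-1 : ℝ) 1,
      ‖((R 0)⁻¹).val * derivWithin (fun s => (R s).val) (Icc (-1) 1) τ‖ ≤ 1 / 10)
    {τ : ℝ} (hτ : τ ∈ Icc (-1 : ℝ) 1) :
    ‖((R τ)⁻¹).val * derivWithin (fun s => (R s).val) (Icc (-1) 1) τ‖ ≤ 1 / 4 := by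
  have h1 := (convex_Icc (-1 : ℝ) 1).norm_image_sub_le_of_norm_hasDerivWithin_le
    (fun s hs => (D.hasDerivWithinAt_R hs).const_mul ((R 0)⁻¹).val) hc
    (show (0 : ℝ) ∈ Icc (-1 : ℝ) 1 by norm_num) hτ
  set Z := ((R τ)⁻¹).val * derivWithin (fun s => (R s).val) (Icc (-1) 1) τ with hZ
  rw [Units.inv_mul, sub_zero] at h1
  have h2 : ‖τ‖ ≤ 1 := abs_le.2 hτ
  have h3 : Z = ((R 0)⁻¹).val * derivWithin (fun s => (R s).val) (Icc (-1) 1) τ -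
      (((R 0)⁻¹).val * (R τ).val - 1) * Z := by
    rw [sub_mul, one_mul, hZ, mul_assoc ((R 0)⁻¹).val, ← mul_assoc (R τ).val, Units.mul_inv,
      one_mul, sub_sub_cancel]
  have h4 : ‖Z‖ ≤ 1 / 10 + 1 / 10 * ‖Z‖ := by
    conv_lhs => rw [h3]
    refine (norm_sub_le _ _).trans (add_le_add (hc τ hτ) ((norm_mul_le _ _).trans ?_))
    gcongr
    linarith
  linarith

theorem exists_norm_R_le (D : BlockData cgt clt A R Agt Alt) :
    ∃ C, ∀ τ ∈ Icc (-1 : ℝ) 1, ‖(R τ).val‖ ≤ C :=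
  isCompact_Icc.exists_bound_of_continuousOn D.smooth_R.continuousOn

end BlockData

/-- The system `ξ' = A(χ) ξ` in the coordinates given by the columns of `R(χ)`. -/
theorem BlockData.exists_splitSystem (D : BlockData cgt clt A R Agt Alt)
    (hh : ContDiffOn ℝ ∞ h (Icc (-1) 1)) (hpos : ∀ τ ∈ Icc (-1 : ℝ) 1, 0 < h τ)
    (hχ : ∀ x, χ x ∈ Ioo (-1 : ℝ) 1)
    (hχd : ∀ x, HasDerivAt χ ((1 - χ x ^ 2) * h (χ x)) x) (hχ0 : χ 0 = 0) {k : ℝ} (hk : 0 < k)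
    (hkR : ∀ τ ∈ Icc (-1 : ℝ) 1,
      ‖((R τ)⁻¹).val * derivWithin (fun s => (R s).val) (Icc (-1) 1) τ‖ ≤ k) :
    ∃ S : SplitSystem (EuclideanSpace ℂ (Fin n ⊕ Fin n)) (EuclideanSpace ℂ (Fin n)),
      (∀ x, S.B x = Matrix.toEuclideanCLM (𝕜 := ℂ) (A (χ x)).val) ∧ S.k = k ∧
      S.Ubot = firstCoord (R (-1)) ∧ S.Vbot = lastCoord (R (-1)) ∧
      S.Utop = firstCoord (R 1) ∧ S.Vtop = lastCoord (R 1) := by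
  have hχI : ∀ x, χ x ∈ Icc (-1 : ℝ) 1 := fun x => Ioo_subset_Icc_self (hχ x)
  have hm1 : (-1 : ℝ) ∈ Icc (-1 : ℝ) 1 := by norm_num
  have hp1 : (1 : ℝ) ∈ Icc (-1 : ℝ) 1 := by norm_num
  obtain ⟨τ₀, hτ₀, hmin⟩ := isCompact_Icc.exists_isMinOn ⟨1, hp1⟩ hh.continuousOn
  have hmin' : ∀ τ ∈ Icc (-1 : ℝ) 1, h τ₀ ≤ h τ := fun τ hτ => hmin hτ
  have htop : Tendsto χ atTop (𝓝[Icc (-1) 1] 1) := tendsto_nhdsWithin_iff.2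
    ⟨tendsto_one_of_logistic (hpos τ₀ hτ₀) hmin' hχ hχd hχ0, Eventually.of_forall hχI⟩
  have hbot : Tendsto χ atBot (𝓝[Icc (-1) 1] (-1)) := tendsto_nhdsWithin_iff.2
    ⟨tendsto_neg_one_of_logistic (hpos τ₀ hτ₀) hmin' hχ hχd hχ0, Eventually.of_forall hχI⟩
  have hσ : ∀ x, 0 ≤ (1 - χ x ^ 2) * h (χ x) := fun x =>
    mul_nonneg (by nlinarith [(hχ x).1, (hχ x).2]) (hpos _ (hχI x)).le
  have hσlim : ∀ {τ : ℝ} {l : Filter ℝ}, τ ∈ Icc (-1 : ℝ) 1 → τ ^ 2 = 1 →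
      Tendsto χ l (𝓝[Icc (-1) 1] τ) →
      Tendsto (fun x => (1 - χ x ^ 2) * h (χ x)) l (𝓝 0) := by
    intro τ l hτ hτ2 hl
    have h1 := ((hl.mono_right nhdsWithin_le_nhds).pow 2).const_sub 1
    have h2 := (hh.continuousOn τ hτ).tendsto.comp hl
    have h3 := h1.mul h2
    rwa [hτ2, sub_self, zero_mul] at h3
  obtain ⟨C, hC⟩ := D.exists_norm_R_le
  have hlim : ∀ (p : EuclideanSpace ℂ (Fin n ⊕ Fin n) →L[ℂ] EuclideanSpace ℂ (Fin n)) {τ : ℝ}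
      {l : Filter ℝ}, τ ∈ Icc (-1 : ℝ) 1 → Tendsto χ l (𝓝[Icc (-1) 1] τ) →
      Tendsto (fun x => p ∘L Matrix.toEuclideanCLM (𝕜 := ℂ) ((R (χ x))⁻¹).val) l
        (𝓝 (p ∘L Matrix.toEuclideanCLM (𝕜 := ℂ) ((R τ)⁻¹).val)) := fun p τ l hτ hl =>
    ((compToEuclideanCLM p).continuous.tendsto _).comp ((D.continuousOn_inv τ hτ).tendsto.comp hl)
  have hbd : ∀ {x a b : ℝ}, FormBound (Agt (χ x)) (Alt (χ x)) a b → _ := fun {x a b} hab =>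
    splitBound_of_formBound (D.block _ (hχI x)) (hσ x) (hkR _ (hχI x)) hab
  have hbdlim : ∀ {τ : ℝ} {l : Filter ℝ}, τ ∈ Icc (-1 : ℝ) 1 → Tendsto χ l (𝓝[Icc (-1) 1] τ) →
      ∃ a b, b < a ∧ ∀ᶠ x in l, FormBound (Agt (χ x)) (Alt (χ x)) a b := fun {τ l} hτ hl =>
    FormBound.eventually (by linarith [D.pos τ hτ]) (D.formBound hτ)
      ((D.continuousOn_Agt τ hτ).tendsto.comp hl) ((D.continuousOn_Alt τ hτ).tendsto.comp hl)
  refine ⟨{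
    B := fun x => Matrix.toEuclideanCLM (𝕜 := ℂ) (A (χ x)).val
    U := fun x => firstCoord (R (χ x))
    V := fun x => lastCoord (R (χ x))
    U' := fun x => _
    V' := fun x => _
    Ubot := firstCoord (R (-1))
    Vbot := lastCoord (R (-1))
    Utop := firstCoord (R 1)
    Vtop := lastCoord (R 1)
    -- The shift makes `s` start at `0`, so that the narrow cone closes up at `-∞`, while `s' = χ'`
    -- is the factor in the coupling.
    s := fun x => χ x + 1
    s' := fun x => (1 - χ x ^ 2) * h (χ x)
    k := k
    C := C
    finrank_eq := finrank_halves
    continuous_B := ?_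
    k_pos := hk
    s_mem := fun x => ⟨by linarith [(hχ x).1], by linarith [(hχ x).2]⟩
    hasDerivAt_s := fun x => (hχd x).add_const 1
    s'_nonneg := hσ
    s_bot := by simpa using (hbot.mono_right nhdsWithin_le_nhds).add_const 1
    s_top := by
      have := (htop.mono_right nhdsWithin_le_nhds).add_const 1
      norm_num at this
      exact this
    s'_bot := hσlim hm1 (by norm_num) hbot
    s'_top := hσlim hp1 (by norm_num) htop
    hasDerivAt_U := fun x => ?_
    hasDerivAt_V := fun x => ?_
    U_bot := hlim _ hm1 hbot
    V_bot := hlim _ hm1 hbot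
    U_top := hlim _ hp1 htop
    V_top := hlim _ hp1 htop
    norm_le := fun x ξ => (norm_le_coord (R (χ x)) ξ).trans (by
      gcongr
      exact hC _ (hχI x))
    bound := fun x => ⟨cgt (χ x), -clt (χ x), by linarith [D.pos _ (hχI x)],
      hbd (D.formBound (hχI x))⟩
    bound_bot := by
      obtain ⟨a, b, hab, h⟩ := hbdlim hm1 hbot
      exact ⟨a, b, hab, h.mono fun x hx => hbd hx⟩
    bound_top := by
      obtain ⟨a, b, hab, h⟩ := hbdlim hp1 htop
      exact ⟨a, b, hab, h.mono fun x hx => hbd hx⟩ },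
    fun x => rfl, rfl, rfl, rfl, rfl, rfl⟩
  · have hiso := AddMonoidHomClass.isometry_of_norm
      (Matrix.toEuclideanCLM (n := Fin n ⊕ Fin n) (𝕜 := ℂ)) Matrix.l2_opNorm_toEuclideanCLM
    exact hiso.continuous.comp (D.smooth_A.continuousOn.comp_continuous
      (continuous_iff_continuousAt.2 fun x => (hχd x).continuousAt) hχI)
  · exact (compToEuclideanCLM (firstHalf n)).hasFDerivAt.comp_hasDerivAt x
      (D.hasDerivAt_inv (hχ x) (hχd x))
  · exact (compToEuclideanCLM (lastHalf n)).hasFDerivAt.comp_hasDerivAt x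
      (D.hasDerivAt_inv (hχ x) (hχd x))

end Concrete

/-! ### The main theorem. -/

theorem mainTheorem5 (n : ℕ) :
    ∃ c : ℝ, 0 < c ∧
      ∀ (cgt clt : ℝ → ℝ) (A R : ℝ → GL (Fin n ⊕ Fin n) ℂ)
        (Agt Alt : ℝ → Matrix (Fin n) (Fin n) ℂ) (h χ : ℝ → ℝ),
        BlockData cgt clt A R Agt Alt →
        ContDiffOn ℝ ∞ h (Icc (-1) 1) →
        (∀ τ ∈ Icc (-1 : ℝ) 1, 0 < h τ) →
        (∀ x, χ x ∈ Ioo (-1 : ℝ) 1) →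
        (∀ x, HasDerivAt χ ((1 - χ x ^ 2) * h (χ x)) x) →
        χ 0 = 0 →
        (∃! X : ℝ → Grass (Fin n ⊕ Fin n) n,
          IsGrassSolution (fun x => (A (χ x)).val) X ∧
            Tendsto X atBot (𝓝 (spanFirst (R (-1))))) ∧
        (∃! X : ℝ → Grass (Fin n ⊕ Fin n) n,
          IsGrassSolution (fun x => (A (χ x)).val) X ∧
            Tendsto X atTop (𝓝 (spanLast (R 1)))) ∧
        ((∀ τ ∈ Icc (-1 : ℝ) 1,
            ‖((R 0)⁻¹).val * derivWithin (fun s => (R s).val) (Icc (-1) 1) τ‖ ≤ c) →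
          (∀ X : ℝ → Grass (Fin n ⊕ Fin n) n,
            IsGrassSolution (fun x => (A (χ x)).val) X →
            Tendsto X atBot (𝓝 (spanFirst (R (-1)))) →
            Tendsto X atTop (𝓝 (spanFirst (R 1)))) ∧
          (∀ X : ℝ → Grass (Fin n ⊕ Fin n) n,
            IsGrassSolution (fun x => (A (χ x)).val) X →
            Tendsto X atTop (𝓝 (spanLast (R 1))) →
            Tendsto X atBot (𝓝 (spanLast (R (-1)))))) := by
  refine ⟨1 / 10, by norm_num, fun cgt clt A R Agt Alt h χ D hh hpos hχ hχd hχ0 => ?_⟩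
  have hfin : Module.finrank ℂ (EuclideanSpace ℂ (Fin n)) = n := by simp
  have main : ∀ k > 0, (∀ τ ∈ Icc (-1 : ℝ) 1,
      ‖((R τ)⁻¹).val * derivWithin (fun s => (R s).val) (Icc (-1) 1) τ‖ ≤ k) → _ :=
    fun k hk hkR => D.exists_splitSystem hh hpos hχ hχd hχ0 hk hkR
  -- Existence and uniqueness use any bound `k`, obtained by compactness; under the smallness
  -- hypothesis a second split system with `k = 1/4` gives the limits.
  obtain ⟨k, hk, hkR⟩ := D.exists_norm_inv_mul_deriv_le
  obtain ⟨S, hB, -, hUb, hVb, hUt, hVt⟩ := main k hk hkR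
  refine ⟨(SplitSystem.existsUnique_grassSolution hfin hB (by rw [hVb, spanFirst_eq_ker])
      (Z := spanFirst (R 1)) (by rw [hVt, spanFirst_eq_ker])).1,
    (SplitSystem.existsUnique_grassSolution_reverse hfin hB (by rw [hUt, spanLast_eq_ker])
      (Z := spanLast (R (-1))) (by rw [hUb, spanLast_eq_ker])).1, fun hc => ?_⟩
  obtain ⟨S, hB, hSk, hUb, hVb, hUt, hVt⟩ := main (1 / 4) (by norm_num)
    fun τ hτ => D.norm_inv_mul_deriv_le_of_le hc hτ
  exact ⟨(SplitSystem.existsUnique_grassSolution hfin hB (by rw [hVb, spanFirst_eq_ker])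
      (by rw [hVt, spanFirst_eq_ker])).2 hSk.le,
    (SplitSystem.existsUnique_grassSolution_reverse hfin hB (by rw [hUt, spanLast_eq_ker])
      (by rw [hUb, spanLast_eq_ker])).2 hSk.le⟩
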